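/- Let $G=(V,E)$ be a finite simple graph and $M$ a matching in $G$. A vertex is unmatched if it is covered by no edge of $M$; an alternating path is a simple path whose consecutive edges alternate between $M$ and $E\setminus M$ (the path of length $0$ is allowed). For a vertex $v$, $\mathrm{evenlevel}(v)$ (resp. $\mathrm{oddlevel}(v)$) is the length of a minimum even (resp. odd) length alternating path from an unmatched vertex to $v$, and $\infty$ if there is none; each alternating path from an unmatched vertex to $v$ attaining this minimum is an evenlevel$(v)$ (resp. oddlevel$(v)$) path. The smaller and the larger of these two numbers are $\mathrm{minlevel}(v)$ and $\mathrm{maxlevel}(v)$, and a minlevel$(v)$ (maxlevel$(v)$) path is an evenlevel$(v)$ or oddlevel$(v)$ path whose length is $\mathrm{minlevel}(v)$ ($\mathrm{maxlevel}(v)$). The tenacity of $v$ is $\mathrm{evenlevel}(v)+\mathrm{oddlevel}(v)$; the tenacity of an edge $(u,v)$ is $\mathrm{evenlevel}(u)+\mathrm{evenlevel}(v)+1$ if $(u,v)\notin M$ and $\mathrm{oddlevel}(u)+\mathrm{oddlevel}(v)+1$ if $(u,v)\in M$. An edge $(u,v)$ is a prop if it is the last edge of some minlevel$(u)$ path or of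 some minlevel$(v)$ path; every other edge of $G$ is a bridge. Let $l_m$ be the minimum length of an augmenting path (an alternating path between two distinct unmatched vertices), with $l_m=\infty$ if there is none. Theorem. Let $v$ be a vertex of tenacity $t\le l_m$ and let $p$ be a maxlevel$(v)$ path. Then $p$ contains exactly one bridge of tenacity $t$. -/

import Mathlib

noncomputable section

namespace AltPath

variable {V : Type*} {G : SimpleGraph V}

/-- A vertex is unmatched if no edge of the matching `M` covers it. -/
def IsUnmatched (M : G.Subgraph) (v : V) : Prop := v ∉ M.verts

/-- An alternating path: a walk without repeated vertices whose consecutive edges alternate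
between edges in `M` and edges not in `M`. -/
def IsAlternatingPath (M : G.Subgraph) {u v : V} (p : G.Walk u v) : Prop :=
  p.IsPath ∧ p.edges.IsChain (fun e e' => e ∈ M.edgeSet ↔ e' ∉ M.edgeSet)

/-- An alternating path to `v` that starts at an unmatched vertex. -/
def IsAlternatingPathTo (M : G.Subgraph) {f v : V} (p : G.Walk f v) : Prop :=
  IsUnmatched M f ∧ IsAlternatingPath M p

/-- An augmenting path: an alternating path between two distinct unmatched vertices. -/
def IsAugmentingPath (M : G.Subgraph) {f g : V} (p : G.Walk f g) : Prop :=
  f ≠ g ∧ IsUnmatched M f ∧ IsUnmatched M g ∧ IsAlternatingPath M p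

/-- The length of a minimum length augmenting path (`⊤` if there is none). -/
def minAugLength (M : G.Subgraph) : ℕ∞ :=
  ⨅ (f : V) (g : V) (p : G.Walk f g) (_ : IsAugmentingPath M p), (p.length : ℕ∞)

/-- The length of a minimum even length alternating path from an unmatched vertex to `v`
(`⊤` if there is none). -/
def evenLevel (M : G.Subgraph) (v : V) : ℕ∞ :=
  ⨅ (f : V) (p : G.Walk f v) (_ : IsAlternatingPathTo M p ∧ Even p.length), (p.length : ℕ∞)

/-- The length of a minimum odd length alternating path from an unmatched vertex to `v`
(`⊤` if there is none). -/
def oddLevel (M : G.Subgraph) (v : V) : ℕ∞ :=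
  ⨅ (f : V) (p : G.Walk f v) (_ : IsAlternatingPathTo M p ∧ Odd p.length), (p.length : ℕ∞)

/-- `p` is an evenlevel path of its last vertex. -/
def IsEvenLevelPath (M : G.Subgraph) {f v : V} (p : G.Walk f v) : Prop :=
  IsAlternatingPathTo M p ∧ Even p.length ∧ (p.length : ℕ∞) = evenLevel M v

/-- `p` is an oddlevel path of its last vertex. -/
def IsOddLevelPath (M : G.Subgraph) {f v : V} (p : G.Walk f v) : Prop :=
  IsAlternatingPathTo M p ∧ Odd p.length ∧ (p.length : ℕ∞) = oddLevel M v

/-- The smaller of the two levels. -/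
def minLevel (M : G.Subgraph) (v : V) : ℕ∞ := min (evenLevel M v) (oddLevel M v)

/-- The bigger of the two levels. -/
def maxLevel (M : G.Subgraph) (v : V) : ℕ∞ := max (evenLevel M v) (oddLevel M v)

/-- `p` is a minlevel path of its last vertex. -/
def IsMinLevelPath (M : G.Subgraph) {f v : V} (p : G.Walk f v) : Prop :=
  (IsEvenLevelPath M p ∨ IsOddLevelPath M p) ∧ (p.length : ℕ∞) = minLevel M v

/-- `p` is a maxlevel path of its last vertex. -/
def IsMaxLevelPath (M : G.Subgraph) {f v : V} (p : G.Walk f v) : Prop :=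
  (IsEvenLevelPath M p ∨ IsOddLevelPath M p) ∧ (p.length : ℕ∞) = maxLevel M v

/-- The tenacity of a vertex. -/
def tenacity (M : G.Subgraph) (v : V) : ℕ∞ := evenLevel M v + oddLevel M v

open Classical in
/-- The tenacity of an edge: `evenlevel u + evenlevel v + 1` for an unmatched edge `uv`,
`oddlevel u + oddlevel v + 1` for a matched one. -/
def edgeTenacity (M : G.Subgraph) : Sym2 V → ℕ∞ :=
  Sym2.lift ⟨fun u v =>
    if M.Adj u v then oddLevel M u + oddLevel M v + 1
    else evenLevel M u + evenLevel M v + 1, by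
      intro u v
      beta_reduce
      simp only [M.adj_comm u v, add_comm (oddLevel M u), add_comm (evenLevel M u)]⟩

/-- `u` is a predecessor of `v`: `uv` is the last edge of some minlevel path of `v`. -/
def IsPredecessor (M : G.Subgraph) (u v : V) : Prop :=
  ∃ (f : V) (p : G.Walk f v), IsMinLevelPath M p ∧ ¬ p.Nil ∧ p.penultimate = u

/-- An edge is a prop if one of its endpoints is a predecessor of the other. -/
def IsPropEdge (M : G.Subgraph) (e : Sym2 V) : Prop :=
  ∃ u v : V, IsPredecessor M u v ∧ e = s(u, v)

/-- A bridge is an edge of the graph that is not a prop. -/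
def IsBridgeEdge (M : G.Subgraph) (e : Sym2 V) : Prop :=
  e ∈ G.edgeSet ∧ ¬ IsPropEdge M e

end AltPath

end

/-!
The proof works with the dual variables of Edmonds' search, written down explicitly in terms of the
levels, instead of with an algorithm.

Write `t = 2 * S + 1` for the tenacity in question. For every `s`, the edges of tenacity less than
`2 * s` span a graph whose connected components play the role of blossoms (`Levels.Sim`). As long as
`2 * s - 1` is smaller than the length of every augmenting path, each component has exactly one
vertex of tenacity at least `2 * s`, its base (`Levels.GoodBase`). Given this for all `s ≤ S`,
let `kap v` be the dual variable of `v`. Dual feasibility (`Levels.slack_nonneg`) is immediate from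
the definition of the components, and the `defect` of an alternating path, the amount by which its
length exceeds what the dual variables and the blossoms force, starts at `0` and never decreases
along the path (`Levels.defect_succ`, `Levels.excess_nonneg`): a blossom entered elsewhere than
through its base costs `2`, which is recovered only by leaving it through its base.

The defect of a shortest path therefore vanishes throughout (`Levels.tight_of_even`,
`Levels.tight_of_odd`). Hence all its unmatched edges are tight, and at every even index the path
either rises (the current blossom was entered through its base, which is reached first by an even
path) or falls (the current vertex is a base reached first by an odd path, or the current
blossom was entered elsewhere than through its base). Tightness forbids rising after having fallen.
A maxlevel path starts rising and ends falling, so it turns exactly once. A local inspection shows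
that the edge where it turns is a bridge of tenacity `t`, and that every other edge is a prop or has
tenacity different from `t` (`Levels.Tight.bridges`).

It remains to prove uniqueness of bases, by induction on `s` (`Levels.goodBase_succ`). A vertex of
tenacity `t` is sent to its anchor, the last vertex of tenacity greater than `t` on
a rising path to it. If the two sides of a bridge, or two rising paths to the same vertex, had
different anchors, then one of the anchors could be reached by an odd path that ascends
on one side, crosses the bridge, and descends on the other side. That path would be so short that
the anchor had tenacity at most `t` (`Levels.fork`). So anchors are well defined
(`Levels.anchor_unique`, `Levels.lands_unique`) and constant along the edges of tenacity at most `t`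
(`Levels.Anchor.eq_of_adj`).
-/

namespace AltPath

variable {V : Type*} {G : SimpleGraph V} {M : G.Subgraph} {L S : ℕ}

/-! ### Alternating paths as vertex sequences -/

/-- The first `n + 1` terms of `x` are the vertices of an alternating path of length `n` that
starts at an unmatched vertex. Its edges are then matched exactly at the odd positions. -/
structure Alt (M : G.Subgraph) (x : ℕ → V) (n : ℕ) : Prop where
  free : x 0 ∉ M.verts
  adj : ∀ i < n, G.Adj (x i) (x (i + 1))
  mem_iff : ∀ i < n, (M.Adj (x i) (x (i + 1)) ↔ Odd i)
  inj : ∀ i ≤ n, ∀ j ≤ n, x i = x j → i = j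

theorem Alt.mono {x : ℕ → V} {n m : ℕ} (h : Alt M x n) (hm : m ≤ n) : Alt M x m where
  free := h.free
  adj i hi := h.adj i (by omega)
  mem_iff i hi := h.mem_iff i (by omega)
  inj i hi j hj := h.inj i (by omega) j (by omega)

/-- The sequence `q 0, …, q a, d 0, d 1, …`. -/
def joinAt (q : ℕ → V) (a : ℕ) (d : ℕ → V) (i : ℕ) : V := if i ≤ a then q i else d (i - (a + 1))

theorem joinAt_of_le {q d : ℕ → V} {a i : ℕ} (h : i ≤ a) : joinAt q a d i = q i := if_pos h

theorem joinAt_add {q d : ℕ → V} {a : ℕ} (j : ℕ) : joinAt q a d (a + 1 + j) = d j := by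
  rw [joinAt, if_neg (by omega)]; congr 1; omega

theorem Alt.append {q d : ℕ → V} {a b : ℕ} (hq : Alt M q a) (hadj : G.Adj (q a) (d 0))
    (hm : M.Adj (q a) (d 0) ↔ Odd a) (hd : ∀ i < b, G.Adj (d i) (d (i + 1)))
    (hdm : ∀ i < b, (M.Adj (d i) (d (i + 1)) ↔ Odd (a + 1 + i)))
    (hinj : ∀ i ≤ b, ∀ j ≤ b, d i = d j → i = j) (hdisj : ∀ i ≤ a, ∀ j ≤ b, q i ≠ d j) :
    Alt M (joinAt q a d) (a + 1 + b) := by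
  have key : ∀ i, i < a ∨ i = a ∨ ∃ j, i = a + 1 + j := by
    intro i
    rcases lt_trichotomy i a with h | h | h
    · exact Or.inl h
    · exact Or.inr (Or.inl h)
    · exact Or.inr (Or.inr ⟨i - (a + 1), by omega⟩)
  refine ⟨?_, ?_, ?_, ?_⟩
  · rw [joinAt_of_le (Nat.zero_le _)]; exact hq.free
  · intro i hi
    rcases key i with h | rfl | ⟨j, rfl⟩
    · rw [joinAt_of_le h.le, joinAt_of_le h]; exact hq.adj i h
    · rw [joinAt_of_le le_rfl]; exact (joinAt_add (q := q) (d := d) (a := i) 0).symm ▸ hadj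
    · rw [joinAt_add, add_assoc, joinAt_add]; exact hd j (by omega)
  · intro i hi
    rcases key i with h | rfl | ⟨j, rfl⟩
    · rw [joinAt_of_le h.le, joinAt_of_le h]; exact hq.mem_iff i h
    · rw [joinAt_of_le le_rfl]; exact (joinAt_add (q := q) (d := d) (a := i) 0).symm ▸ hm
    · rw [joinAt_add, add_assoc (a + 1) j 1, joinAt_add]; exact hdm j (by omega)
  · have key' : ∀ i, i ≤ a ∨ ∃ j, i = a + 1 + j := by
      intro i
      rcases le_or_gt i a with h | h
      · exact Or.inl h
      · exact Or.inr ⟨i - (a + 1), by omega⟩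
    intro i hi j hj hij
    rcases key' i with h | ⟨i', rfl⟩ <;> rcases key' j with h' | ⟨j', rfl⟩
    · rw [joinAt_of_le h, joinAt_of_le h'] at hij; exact hq.inj i h j h' hij
    · rw [joinAt_of_le h, joinAt_add] at hij; exact absurd hij (hdisj i h j' (by omega))
    · rw [joinAt_of_le h', joinAt_add] at hij; exact absurd hij.symm (hdisj j h' i' (by omega))
    · rw [joinAt_add, joinAt_add] at hij
      rw [hinj i' (by omega) j' (by omega) hij]

theorem Alt.snoc {q : ℕ → V} {a : ℕ} {w : V} (hq : Alt M q a) (hadj : G.Adj (q a) w)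
    (hm : M.Adj (q a) w ↔ Odd a) (hw : ∀ i ≤ a, q i ≠ w) :
    Alt M (joinAt q a fun _ => w) (a + 1) :=
  hq.append (b := 0) (d := fun _ => w) hadj hm (by simp) (by simp) (by simp)
    (fun i hi _ _ => hw i hi)

theorem joinAt_succ {q d : ℕ → V} {a : ℕ} : joinAt q a d (a + 1) = d 0 := joinAt_add 0

theorem adj_unique (hM : M.IsMatching) {v w w' : V} (h : M.Adj v w) (h' : M.Adj v w') : w = w' :=
  (hM (M.edge_vert h)).unique h h'

/-- The mate of a vertex of a path is the next vertex if the index is odd, unless the path ends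
there, and the previous vertex if the index is even. -/
theorem Alt.index_of_mate (hM : M.IsMatching) {x : ℕ → V} {n i : ℕ} {w : V} (h : Alt M x n)
    (hi : i ≤ n) (hw : M.Adj (x i) w) :
    (Odd i ∧ (i < n → x (i + 1) = w)) ∨ (Even i ∧ 0 < i ∧ x (i - 1) = w) := by
  rcases Nat.even_or_odd i with he | ho
  · right
    rcases Nat.eq_zero_or_pos i with h0 | h0
    · subst h0; exact absurd (M.edge_vert hw) h.free
    · refine ⟨he, h0, ?_⟩
      have hodd : Odd (i - 1) := Nat.Even.sub_odd h0 he odd_one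
      have := (h.mem_iff (i - 1) (by omega)).2 hodd
      rw [Nat.sub_add_cancel h0] at this
      exact adj_unique hM this.symm hw
  · left
    exact ⟨ho, fun hlt => adj_unique hM ((h.mem_iff i hlt).2 ho) hw⟩

/-! ### Truncated levels -/

/-- Even levels `E` and odd levels `O`, as natural numbers truncated at the cap `L`: a level that
is infinite or at least `L` is recorded as `L`. -/
structure Levels (M : G.Subgraph) (L : ℕ) where
  /-- The truncated even level. -/
  E : V → ℕ
  /-- The truncated odd level. -/
  O : V → ℕ
  E_cap : ∀ v, E v ≤ L
  O_cap : ∀ v, O v ≤ L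
  E_le : ∀ x n, Alt M x n → Even n → E (x n) ≤ n
  O_le : ∀ x n, Alt M x n → Odd n → O (x n) ≤ n
  E_att : ∀ v, E v < L → Even (E v) ∧ ∃ x, Alt M x (E v) ∧ x (E v) = v
  O_att : ∀ v, O v < L → Odd (O v) ∧ ∃ x, Alt M x (O v) ∧ x (O v) = v

namespace Levels

variable (D : Levels M L)

/-- The truncated tenacity of a vertex. -/
def ten (v : V) : ℕ := D.E v + D.O v

theorem E_mate_le (hM : M.IsMatching) {v w : V} (h : M.Adj v w) : D.E v ≤ D.O w + 1 := by
  rcases (D.O_cap w).lt_or_eq with hL | hL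
  · obtain ⟨ho, x, hx, hxw⟩ := D.O_att w hL
    have hne : ∀ i ≤ D.O w, x i ≠ v := by
      rintro i hi rfl
      rcases hx.index_of_mate hM hi h with ⟨hio, hi1⟩ | ⟨hie, hi0, hi1⟩
      · rcases hi.lt_or_eq with hlt | heq
        · have := hx.inj _ (by omega) _ le_rfl ((hi1 hlt).trans hxw.symm)
          rw [← this] at ho
          exact (Nat.not_even_iff_odd.2 ho) hio.add_one
        · rw [heq, hxw] at h; exact M.loopless.irrefl _ h
      · have := hx.inj _ (by omega) _ le_rfl (hi1.trans hxw.symm)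
        omega
    have := D.E_le _ _ (hx.snoc (w := v) (by rw [hxw]; exact (M.adj_sub h).symm)
      (by rw [hxw]; exact ⟨fun _ => ho, fun _ => h.symm⟩) hne) ho.add_one
    rwa [joinAt_succ] at this
  · have := D.E_cap v; omega

theorem O_mate_lt (hM : M.IsMatching) {v w : V} (h : M.Adj v w) (hL : D.E v < L) :
    D.O w + 1 ≤ D.E v := by
  obtain ⟨he, x, hx, hxv⟩ := D.E_att v hL
  rcases hx.index_of_mate hM le_rfl (w := w) (by rwa [hxv]) with ⟨ho, -⟩ | ⟨-, h0, h1⟩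
  · exact absurd he (Nat.not_even_iff_odd.2 ho)
  · have := D.O_le _ _ (hx.mono (Nat.sub_le (D.E v) 1)) (Nat.Even.sub_odd h0 he odd_one)
    rw [h1] at this
    omega

theorem E_mate (hM : M.IsMatching) {v w : V} (h : M.Adj v w) :
    D.E v = min (D.O w + 1) L := by
  have h1 := D.E_mate_le hM h
  have h2 := D.E_cap v
  rcases h2.lt_or_eq with hL | hL
  · have := D.O_mate_lt hM h hL; omega
  · omega

theorem E_free {f : V} (h : f ∉ M.verts) : D.E f = 0 :=
  Nat.le_zero.1 <| D.E_le (fun _ => f) 0 ⟨h, by simp, by simp, by simp⟩ Even.zero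

/-- An even level path to `v` either reaches `u` or extends to `u`. -/
theorem O_le_or_E_le {u v : V} (h : G.Adj u v) (hm : ¬ M.Adj u v) :
    D.O u ≤ D.E v + 1 ∨ D.E u ≤ D.E v := by
  rcases (D.E_cap v).lt_or_eq with hL | hL
  · obtain ⟨he, x, hx, hxv⟩ := D.E_att v hL
    by_cases hu : ∃ i ≤ D.E v, x i = u
    · obtain ⟨i, hi, rfl⟩ := hu
      rcases Nat.even_or_odd i with hie | hio
      · right; exact (D.E_le _ _ (hx.mono hi) hie).trans hi
      · left; exact (D.O_le _ _ (hx.mono hi) hio).trans (by omega)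
    · push Not at hu
      left
      have := D.O_le _ _ (hx.snoc (w := u) (by rw [hxv]; exact h.symm)
        (by rw [hxv]; exact ⟨fun h' => absurd h'.symm hm,
              fun h' => absurd he (Nat.not_even_iff_odd.2 h')⟩) hu) he.add_one
      rwa [joinAt_succ] at this
  · right; have := D.E_cap u; omega

theorem E_even {v : V} (h : D.E v < L) : D.E v % 2 = 0 := Nat.even_iff.1 (D.E_att v h).1

theorem O_odd {v : V} (h : D.O v < L) : D.O v % 2 = 1 := Nat.odd_iff.1 (D.O_att v h).1

/-! ### Blossoms as connected components -/

/-- The graph formed by the edges of tenacity less than `2 * s`. -/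
def lowGraph (s : ℕ) : SimpleGraph V where
  Adj u v := G.Adj u v ∧ ((M.Adj u v ∧ D.O u + D.O v + 1 < 2 * s) ∨
    (¬ M.Adj u v ∧ D.E u + D.E v + 1 < 2 * s))
  symm := ⟨fun u v h => ⟨h.1.symm, by
    rw [M.adj_comm, add_comm (D.O v), add_comm (D.E v)]; exact h.2⟩⟩
  loopless := ⟨fun u h => G.loopless.irrefl u h.1⟩

/-- `u` and `v` lie in the same blossom of tenacity less than `2 * s`: they are connected by edges
of tenacity less than `2 * s`. -/
def Sim (s : ℕ) (u v : V) : Prop := (D.lowGraph s).Reachable u v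

variable {D}

theorem Sim.refl {s : ℕ} (u : V) : D.Sim s u u := SimpleGraph.Reachable.refl u
theorem Sim.symm {s : ℕ} {u v : V} (h : D.Sim s u v) : D.Sim s v u := SimpleGraph.Reachable.symm h
theorem Sim.trans {s : ℕ} {u v w : V} (h : D.Sim s u v) (h' : D.Sim s v w) : D.Sim s u w :=
  SimpleGraph.Reachable.trans h h'

theorem Sim.mono {s s' : ℕ} (hs : s ≤ s') {u v : V} (h : D.Sim s u v) : D.Sim s' u v :=
  SimpleGraph.Reachable.mono (show D.lowGraph s ≤ D.lowGraph s' from fun _ _ hab => ⟨hab.1, by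
    rcases hab.2 with h | h
    · exact Or.inl ⟨h.1, by omega⟩
    · exact Or.inr ⟨h.1, by omega⟩⟩) h

theorem sim_of_unmatched {s : ℕ} {u v : V} (h : G.Adj u v) (hm : ¬ M.Adj u v)
    (hs : D.E u + D.E v + 1 < 2 * s) : D.Sim s u v :=
  SimpleGraph.Adj.reachable (G := D.lowGraph s) ⟨h, Or.inr ⟨hm, hs⟩⟩

theorem ten_mate (hM : M.IsMatching) {s : ℕ} (hs : 2 * s ≤ L) {u v : V} (h : M.Adj u v) :
    D.ten u < 2 * s ↔ D.ten v < 2 * s := by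
  have h1 := D.E_mate hM h
  have h2 := D.E_mate hM h.symm
  have := D.O_cap u
  have := D.O_cap v
  unfold ten
  omega

theorem sim_of_matched (hM : M.IsMatching) {s : ℕ} (hs : 2 * s ≤ L) {u v : V} (h : M.Adj u v)
    (ht : D.ten u < 2 * s) : D.Sim s u v := by
  have h2 := D.E_mate hM h.symm
  have h1 := D.E_mate hM h
  have := D.O_cap u
  unfold ten at ht
  exact SimpleGraph.Adj.reachable (G := D.lowGraph s) ⟨M.adj_sub h, Or.inl ⟨h, by omega⟩⟩

variable (D)

/-- Every class of `Sim s` has exactly one vertex of tenacity at least `2 * s`, its base. -/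
structure GoodBase (s : ℕ) : Prop where
  exists_base : ∀ v, ∃ b, D.Sim s v b ∧ 2 * s ≤ D.ten b
  unique : ∀ b b', D.Sim s b b' → 2 * s ≤ D.ten b → 2 * s ≤ D.ten b' → b = b'

variable {D}

/-- The base of a class with more than one vertex is reached first by an even path. -/
theorem base_outer (hM : M.IsMatching) {s : ℕ} (hs : 2 * s ≤ L) {b x : V} (h : D.Sim s b x)
    (hne : b ≠ x) (hb : 2 * s ≤ D.ten b) : D.E b ≤ s ∧ s ≤ D.O b := by
  obtain ⟨p⟩ := h
  cases p with
  | nil => exact absurd rfl hne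
  | @cons _ y _ hadj _ =>
    obtain ⟨ha, ⟨hm, hlt⟩ | ⟨hm, hlt⟩⟩ := hadj
    · have h1 := D.E_mate hM hm
      have h2 := D.E_mate hM hm.symm
      unfold ten at hb
      omega
    · have := D.O_le_or_E_le ha hm
      have he := D.E_even (v := b) (by omega)
      have he' := D.E_even (v := y) (by omega)
      unfold ten at hb
      omega

end Levels

/-! ### The dual potential and its defect along a path -/

open Classical in
/-- The integer `1` or `0` according to the truth of `p`. -/
noncomputable def ind (p : Prop) : ℤ := if p then 1 else 0

theorem ind_of {p : Prop} (h : p) : ind p = 1 := if_pos h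
theorem ind_of_not {p : Prop} (h : ¬ p) : ind p = 0 := if_neg h
theorem ind_eq {p : Prop} : (p ∧ ind p = 1) ∨ (¬ p ∧ ind p = 0) := by
  by_cases h : p
  · exact Or.inl ⟨h, ind_of h⟩
  · exact Or.inr ⟨h, ind_of_not h⟩
theorem ind_nonneg (p : Prop) : 0 ≤ ind p := by
  rcases ind_eq (p := p) with h | h <;> omega
theorem ind_mono {p q : Prop} (h : p → q) : ind p ≤ ind q := by
  rcases ind_eq (p := p) with h1 | h1
  · rw [h1.2, ind_of (h h1.1)]
  · rw [h1.2]; exact ind_nonneg q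

theorem sum_ind_lt (T a : ℕ) :
    ∑ s ∈ Finset.range T, ind (a < 2 * s) = (T : ℤ) - min T (a / 2 + 1) := by
  induction T with
  | zero => simp
  | succ k ih =>
    rw [Finset.sum_range_succ, ih]
    rcases ind_eq (p := a < 2 * k) with h | h <;> rw [h.2] <;> have := h.1 <;> push_cast <;> omega

namespace Levels

variable (D : Levels M L)

/-- The dual variable of `v` after `T` dual adjustments in the primal-dual search, shifted so that
it is `0` at the unmatched vertices. It is a lower bound for the length of even alternating paths
to `v`, and equals `E v` once `v` has been reached by an even path or absorbed in a blossom. -/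
def kap (T : ℕ) (v : V) : ℕ := min (D.E v) (max T (2 * T - 1 - D.O v))

/-- The slack of the dual constraint of the unmatched edge `uv`: every blossom containing
the edge contributes `2`. -/
noncomputable def slack (T : ℕ) (u v : V) : ℤ :=
  D.kap T u + D.kap T v + 2 - 2 * T + 2 * ∑ s ∈ Finset.range T, ind (D.Sim s u v)

/-- The first `j + 1` vertices of `x` do not include the base of the class of `x j`: the path
has entered the blossom of `x j` elsewhere than through its base. -/
def Away (s : ℕ) (x : ℕ → V) (j : ℕ) : Prop :=
  ∀ i ≤ j, D.Sim s (x i) (x j) → D.ten (x i) < 2 * s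

/-- By how much the length of the path up to the (even) index `j` exceeds the length
forced by the dual variables. -/
noncomputable def defect (T : ℕ) (x : ℕ → V) (j : ℕ) : ℤ :=
  j - D.kap T (x j) - 2 * ∑ s ∈ Finset.range T, ind (D.Away s x j)

/-- The contribution of the blossoms of level `s` to the change of the defect from `j` to
`j + 2`. -/
noncomputable def excess (s : ℕ) (x : ℕ → V) (j : ℕ) : ℤ :=
  ind (D.ten (x (j + 1)) < 2 * s) + ind (D.Away s x j) - ind (D.Sim s (x j) (x (j + 1)))
    - ind (D.Away s x (j + 2))

variable {D}

theorem slack_nonneg {T : ℕ} (hT : 2 * T ≤ L) {u v : V} (h : G.Adj u v) (hm : ¬ M.Adj u v) :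
    0 ≤ D.slack T u v := by
  have h1 : ∑ s ∈ Finset.range T, ind (D.E u + D.E v + 1 < 2 * s) ≤
      ∑ s ∈ Finset.range T, ind (D.Sim s u v) :=
    Finset.sum_le_sum fun s _ => ind_mono (sim_of_unmatched h hm)
  rw [sum_ind_lt] at h1
  have h0 : 0 ≤ ∑ s ∈ Finset.range T, ind (D.Sim s u v) :=
    Finset.sum_nonneg fun s _ => ind_nonneg _
  have h2 := D.O_le_or_E_le h hm
  have h3 := D.O_le_or_E_le h.symm (fun h' => hm h'.symm)
  have h4 := D.E_even (v := u)
  have h5 := D.E_even (v := v)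
  unfold slack kap
  omega

theorem kap_mate (hM : M.IsMatching) {T : ℕ} (hT : 2 * T < L) {w z : V} (h : M.Adj w z) :
    (D.kap T w : ℤ) + D.kap T z + 2 * ∑ s ∈ Finset.range T, ind (D.ten w < 2 * s) = 2 * T := by
  rw [sum_ind_lt]
  have h1 := D.E_mate hM h
  have h2 := D.E_mate hM h.symm
  have h3 := D.E_even (v := w)
  have h4 := D.O_odd (v := w)
  have := D.O_cap w
  have := D.O_cap z
  unfold kap ten
  rcases Nat.lt_or_ge (D.E w + D.O w) (2 * T) with hlt | hge <;> omega

theorem defect_succ (hM : M.IsMatching) {T : ℕ} (hT : 2 * T < L) {x : ℕ → V} {n j : ℕ}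
    (hx : Alt M x n) (hj : Even j) (hjn : j + 2 ≤ n) :
    D.defect T x (j + 2) = D.defect T x j + D.slack T (x j) (x (j + 1)) +
      2 * ∑ s ∈ Finset.range T, D.excess s x j := by
  have hmz : M.Adj (x (j + 1)) (x (j + 2)) := (hx.mem_iff (j + 1) (by omega)).2 hj.add_one
  have := kap_mate (D := D) hM hT hmz
  unfold defect slack excess
  simp only [Finset.sum_sub_distrib, Finset.sum_add_distrib]
  push_cast
  linarith

theorem not_away_of_base {s : ℕ} {x : ℕ → V} {j : ℕ} (h : 2 * s ≤ D.ten (x j)) :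
    ¬ D.Away s x j := fun h' => absurd (h' j le_rfl (Sim.refl _)) (by omega)

theorem exists_base_of_not_away {s : ℕ} {x : ℕ → V} {j : ℕ} (h : ¬ D.Away s x j) :
    ∃ i ≤ j, D.Sim s (x i) (x j) ∧ 2 * s ≤ D.ten (x i) := by
  unfold Away at h; push Not at h; exact h

/-- A blossom is left through its base at most once, so that no level ever decreases the
defect. -/
theorem excess_nonneg (hM : M.IsMatching) {s : ℕ} (hs : 2 * s ≤ L) (hB : D.GoodBase s)
    {x : ℕ → V} {n j : ℕ} (hx : Alt M x n) (hj : Even j) (hjn : j + 2 ≤ n) :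
    0 ≤ D.excess s x j := by
  have hmz : M.Adj (x (j + 1)) (x (j + 2)) := (hx.mem_iff (j + 1) (by omega)).2 hj.add_one
  have hmate := ten_mate (D := D) hM hs hmz
  unfold excess
  rcases ind_eq (p := D.ten (x (j + 1)) < 2 * s) with ⟨hw, ew⟩ | ⟨hw, ew⟩
  · have hwz := sim_of_matched hM hs hmz hw
    rcases ind_eq (p := D.Sim s (x j) (x (j + 1))) with ⟨hxw, es⟩ | ⟨hxw, es⟩
    · have : ind (D.Away s x (j + 2)) ≤ ind (D.Away s x j) := ind_mono fun ha i hi hsim =>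
        ha i (by omega) (hsim.trans (hxw.trans hwz))
      omega
    · have := ind_nonneg (D.Away s x j)
      rcases ind_eq (p := D.Away s x (j + 2)) with h | h <;> omega
  · have hz : ¬ D.Away s x (j + 2) := not_away_of_base (by omega)
    rw [ew, ind_of_not hz]
    rcases ind_eq (p := D.Sim s (x j) (x (j + 1))) with ⟨hxw, es⟩ | ⟨hxw, es⟩
    · have : D.Away s x j := by
        by_contra hna
        obtain ⟨i, hi, hsim, hb⟩ := exists_base_of_not_away hna
        have := hx.inj _ (by omega) _ (by omega)
          (hB.unique _ _ (hsim.trans hxw) hb (by omega))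
        omega
      rw [ind_of this]; omega
    · have := ind_nonneg (D.Away s x j); omega

/-- Hypotheses on the number `T` of dual adjustments: they stay below the cap, no augmenting path
is shorter than `2 * T - 1`, and the blossoms formed earlier are well structured. -/
structure Stage (D : Levels M L) (T : ℕ) : Prop where
  matching : M.IsMatching
  pos : 0 < T
  cap : 2 * T < L
  O_free : ∀ f ∉ M.verts, 2 * T ≤ D.O f + 1
  good : ∀ s < T, D.GoodBase s

theorem defect_zero {T : ℕ} (hS : D.Stage T) {x : ℕ → V} {n : ℕ} (hx : Alt M x n) :
    D.defect T x 0 = 0 := by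
  have h1 := D.E_free hx.free
  have h2 := hS.O_free _ hx.free
  have : ∑ s ∈ Finset.range T, ind (D.Away s x 0) = 0 := Finset.sum_eq_zero fun s hs =>
    ind_of_not (not_away_of_base (by
      have := Finset.mem_range.1 hs; unfold ten; omega))
  unfold defect kap
  rw [this, h1]; simp

theorem defect_le_succ {T : ℕ} (hS : D.Stage T) {x : ℕ → V} {n j : ℕ} (hx : Alt M x n)
    (hj : Even j) (hjn : j + 2 ≤ n) : D.defect T x j ≤ D.defect T x (j + 2) := by
  rw [defect_succ hS.matching hS.cap hx hj hjn]
  have h1 := slack_nonneg (D := D) hS.cap.le (hx.adj j (by omega))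
    (fun h => Nat.not_even_iff_odd.2 ((hx.mem_iff j (by omega)).1 h) hj)
  have h2 : 0 ≤ ∑ s ∈ Finset.range T, D.excess s x j := Finset.sum_nonneg fun s hs => by
    have := Finset.mem_range.1 hs
    exact excess_nonneg hS.matching (by have := hS.cap; omega) (hS.good s this) hx hj hjn
  omega

theorem defect_mono {T : ℕ} (hS : D.Stage T) {x : ℕ → V} {n : ℕ} (hx : Alt M x n) (a b : ℕ)
    (h : 2 * (a + b) ≤ n) : D.defect T x (2 * a) ≤ D.defect T x (2 * (a + b)) := by
  induction b with
  | zero => exact le_rfl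
  | succ b ih =>
    exact (ih (by omega)).trans (defect_le_succ hS hx (even_two_mul _) (by omega))

theorem defect_nonneg {T : ℕ} (hS : D.Stage T) {x : ℕ → V} {n j : ℕ} (hx : Alt M x n)
    (hj : Even j) (hjn : j ≤ n) : 0 ≤ D.defect T x j := by
  obtain ⟨k, rfl⟩ := hj.two_dvd
  have := defect_mono hS hx 0 k (by omega)
  rw [Nat.zero_add, Nat.mul_zero, defect_zero hS hx] at this
  exact this

/-- A path all of whose even indices up to `m` have defect zero. -/
structure Tight (D : Levels M L) (T : ℕ) (x : ℕ → V) (m : ℕ) : Prop where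
  alt : Alt M x m
  even : Even m
  defect_eq : ∀ j ≤ m, Even j → D.defect T x j = 0

theorem tight_of_defect {T : ℕ} (hS : D.Stage T) {x : ℕ → V} {m : ℕ} (hx : Alt M x m)
    (hm : Even m) (h : D.defect T x m ≤ 0) : D.Tight T x m := by
  refine ⟨hx, hm, fun j hj hje => le_antisymm ?_ (defect_nonneg hS hx hje hj)⟩
  obtain ⟨a, rfl⟩ := hje.two_dvd
  obtain ⟨b, rfl⟩ := hm.two_dvd
  obtain ⟨c, rfl⟩ := Nat.exists_eq_add_of_le (show a ≤ b by omega)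
  exact (defect_mono hS hx a c le_rfl).trans h

theorem Tight.mono {T : ℕ} {x : ℕ → V} {n m : ℕ} (h : D.Tight T x n) (hm : m ≤ n)
    (he : Even m) : D.Tight T x m :=
  ⟨h.alt.mono hm, he, fun j hj => h.defect_eq j (hj.trans hm)⟩

theorem Tight.step {T : ℕ} (hS : D.Stage T) {x : ℕ → V} {m j : ℕ} (h : D.Tight T x m)
    (hj : Even j) (hjm : j + 2 ≤ m) :
    D.slack T (x j) (x (j + 1)) = 0 ∧ ∀ s < T, D.excess s x j = 0 := by
  have h0 := defect_succ (D := D) hS.matching hS.cap h.alt hj hjm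
  rw [h.defect_eq _ hjm (by simpa using hj.add even_two), h.defect_eq _ (by omega) hj] at h0
  have h1 := slack_nonneg (D := D) hS.cap.le (h.alt.adj j (by omega))
    (fun h' => Nat.not_even_iff_odd.2 ((h.alt.mem_iff j (by omega)).1 h') hj)
  have h2 : ∀ s ∈ Finset.range T, 0 ≤ D.excess s x j := fun s hs => by
    have := Finset.mem_range.1 hs
    exact excess_nonneg hS.matching (by have := hS.cap; omega) (hS.good s this) h.alt hj hjm
  have h3 := Finset.sum_nonneg h2
  refine ⟨by omega, fun s hs => ?_⟩
  exact (Finset.sum_eq_zero_iff_of_nonneg h2).1 (by omega) s (Finset.mem_range.2 hs)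

/-- A base on a tight path at an even index is at distance `kap` from the start. -/
theorem Tight.kap_base {T : ℕ} {x : ℕ → V} {m j : ℕ} (h : D.Tight T x m)
    (hj : Even j) (hjm : j ≤ m) (hb : 2 * (T - 1) ≤ D.ten (x j)) : D.kap T (x j) = j := by
  have h0 := h.defect_eq j hjm hj
  have : ∑ s ∈ Finset.range T, ind (D.Away s x j) = 0 := Finset.sum_eq_zero fun s hs =>
    ind_of_not (not_away_of_base (by have := Finset.mem_range.1 hs; omega))
  unfold defect at h0
  omega

/-- A shortest even path is tight and passes through the bases of all blossoms of its last
vertex. -/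
theorem tight_of_even {T : ℕ} (hS : D.Stage T) {x : ℕ → V} {n : ℕ} (hx : Alt M x n)
    (hn : Even n) (hE : D.E (x n) = n) (hk : D.kap T (x n) = D.E (x n)) :
    D.Tight T x n ∧ ∀ s < T, ¬ D.Away s x n := by
  have h2 : ∀ s ∈ Finset.range T, 0 ≤ ind (D.Away s x n) := fun s _ => ind_nonneg _
  have h1 : D.defect T x n = - 2 * ∑ s ∈ Finset.range T, ind (D.Away s x n) := by
    unfold defect; rw [hk, hE]; ring
  have h3 := Finset.sum_nonneg h2
  have ht := tight_of_defect hS hx hn (by rw [h1]; omega)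
  refine ⟨ht, fun s hs ha => ?_⟩
  have h4 := ht.defect_eq n le_rfl hn
  have := (Finset.sum_eq_zero_iff_of_nonneg h2).1 (by omega) s (Finset.mem_range.2 hs)
  rw [ind_of ha] at this
  omega

/-- A shortest odd path to a vertex outside all earlier blossoms is tight up to its last edge. -/
theorem tight_of_odd {T : ℕ} (hS : D.Stage T) {x : ℕ → V} {n : ℕ} (hx : Alt M x (n + 1))
    (hn : Even n) (hk : D.kap T (x (n + 1)) + (n + 1) = 2 * T - 1)
    (hb : 2 * (T - 1) ≤ D.ten (x (n + 1))) :
    D.Tight T x n ∧ D.slack T (x n) (x (n + 1)) = 0 ∧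
      ∀ s < T, (D.Away s x n ↔ D.Sim s (x n) (x (n + 1))) := by
  have hpos := hS.pos
  have h1 := slack_nonneg (D := D) hS.cap.le (hx.adj n (by omega))
    (fun h' => Nat.not_even_iff_odd.2 ((hx.mem_iff n (by omega)).1 h') hn)
  have himp : ∀ s < T, D.Sim s (x n) (x (n + 1)) → D.Away s x n := by
    intro s hs hsim
    by_contra hna
    obtain ⟨i, hi, hsim', hb'⟩ := exists_base_of_not_away hna
    have := hx.inj _ (by omega) _ (by omega)
      ((hS.good s hs).unique _ _ (hsim'.trans hsim) hb' (by omega))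
    omega
  have h2 : ∀ s ∈ Finset.range T,
      0 ≤ ind (D.Away s x n) - ind (D.Sim s (x n) (x (n + 1))) := fun s hs => by
    have := ind_mono (himp s (Finset.mem_range.1 hs)); omega
  have h3 := Finset.sum_nonneg h2
  have h4 : D.defect T x n = - D.slack T (x n) (x (n + 1)) -
      2 * ∑ s ∈ Finset.range T, (ind (D.Away s x n) - ind (D.Sim s (x n) (x (n + 1)))) := by
    unfold defect slack
    rw [Finset.sum_sub_distrib]
    have : (n : ℤ) + D.kap T (x (n + 1)) + 2 - 2 * T = 0 := by omega
    linarith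
  have ht := tight_of_defect hS (hx.mono (Nat.le_succ n)) hn (by omega)
  have h5 := ht.defect_eq n le_rfl hn
  refine ⟨ht, by omega, fun s hs => ⟨fun ha => ?_, himp s hs⟩⟩
  have := (Finset.sum_eq_zero_iff_of_nonneg h2).1 (by omega) s (Finset.mem_range.2 hs)
  by_contra hns
  rw [ind_of ha, ind_of_not hns] at this
  omega

end Levels

namespace Levels

variable (D : Levels M L)

/-! ### The rising and the falling part of a tight path -/

/-- At index `j` the path still rises: it has passed the base of the blossom of `x j`, and this
base is reached first by an even path of length at most `S`. -/
def Up (S : ℕ) (x : ℕ → V) (j : ℕ) : Prop :=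
  ∃ i ≤ j, D.Sim S (x i) (x j) ∧ 2 * S ≤ D.ten (x i) ∧ D.E (x i) ≤ S

/-- At (the even) index `j` the path falls: it has arrived at a base that is reached first by an odd
path, or it has entered a blossom elsewhere than through its base. -/
def Down (S : ℕ) (x : ℕ → V) (j : ℕ) : Prop :=
  (2 * S ≤ D.ten (x j) ∧ D.O (x j) ≤ S) ∨ D.Away S x j

variable {D}

theorem phase_cases (hS : D.Stage (S + 1)) (x : ℕ → V) (j : ℕ) :
    D.Up S x j ∨ D.Down S x j ∨ (2 * S ≤ D.ten (x j) ∧ S < D.E (x j) ∧ S < D.O (x j)) := by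
  by_cases ha : D.Away S x j
  · exact Or.inr (Or.inl (Or.inr ha))
  · obtain ⟨i, hi, hsim, hb⟩ := exists_base_of_not_away ha
    by_cases hE : D.E (x i) ≤ S
    · exact Or.inl ⟨i, hi, hsim, hb, hE⟩
    · have hij : x i = x j := by
        by_contra hne
        exact hE (base_outer hS.matching (by have := hS.cap; omega) hsim hne hb).1
      rw [hij] at hb hE
      by_cases hO : D.O (x j) ≤ S
      · exact Or.inr (Or.inl (Or.inl ⟨hb, hO⟩))
      · exact Or.inr (Or.inr ⟨hb, by omega, by omega⟩)

theorem ten_odd {v : V} (h : D.ten v < L) : D.ten v % 2 = 1 := by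
  unfold ten at *
  have := D.E_even (v := v)
  have := D.O_odd (v := v)
  omega

theorem Up.E_le (hS : D.Stage (S + 1)) {x : ℕ → V} {j : ℕ} (h : D.Up S x j)
    (hb : 2 * S ≤ D.ten (x j)) : D.E (x j) ≤ S := by
  obtain ⟨i, _, hsim, hb', hE⟩ := h
  rwa [(hS.good S (by omega)).unique _ _ hsim hb' hb] at hE

theorem Up.not_down (hS : D.Stage (S + 1)) {x : ℕ → V} {j : ℕ} (h : D.Up S x j) :
    ¬ D.Down S x j := by
  rintro (⟨hb, hO⟩ | ha)
  · have := h.E_le hS hb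
    have h1 := D.E_even (v := x j)
    have h2 := D.O_odd (v := x j)
    have := hS.cap
    unfold ten at hb
    omega
  · obtain ⟨i, hi, hsim, hb, _⟩ := h
    exact absurd (ha i hi hsim) (by omega)

theorem kap_of_ten_le {v : V} (h : D.ten v ≤ 2 * S + 1) : D.kap (S + 1) v = D.E v := by
  unfold ten at h; unfold kap; omega

theorem kap_of_E_le {v : V} (h : D.E v ≤ S + 1) : D.kap (S + 1) v = D.E v := by
  unfold kap; omega

theorem slack_of_not_sim {u v : V} (h : ¬ D.Sim S u v) :
    D.slack (S + 1) u v = D.kap (S + 1) u + D.kap (S + 1) v - 2 * S := by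
  have : ∑ s ∈ Finset.range (S + 1), ind (D.Sim s u v) = 0 := Finset.sum_eq_zero fun s hs =>
    ind_of_not fun h' => h (h'.mono (by have := Finset.mem_range.1 hs; omega))
  unfold slack
  rw [this]; push_cast; ring

theorem slack_of_sim {u v : V} (h : D.Sim S u v) :
    (D.kap (S + 1) u : ℤ) + D.kap (S + 1) v + 2 - 2 * S ≤ D.slack (S + 1) u v := by
  have : 0 ≤ ∑ s ∈ Finset.range S, ind (D.Sim s u v) := Finset.sum_nonneg fun s _ => ind_nonneg _
  unfold slack
  rw [Finset.sum_range_succ, ind_of h]; push_cast; linarith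

/-- A base that is reached only by paths longer than `S` has no tight unmatched edge. -/
theorem not_tight_of_late (hS : D.Stage (S + 1)) {u v : V} (h : G.Adj u v) (hm : ¬ M.Adj u v)
    (hs : D.slack (S + 1) u v = 0) (hb : 2 * S ≤ D.ten u) (hE : S < D.E u) :
    D.O u ≤ S := by
  by_contra hO
  have hns : ¬ D.Sim S u v := fun hsim => by
    have := base_outer hS.matching (by have := hS.cap; omega) hsim h.ne hb
    omega
  rw [slack_of_not_sim hns] at hs
  have := D.O_le_or_E_le h hm
  unfold kap at hs
  omega

/-- A tight unmatched edge at a base reached first by an odd path leads down to a vertex from which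
this base is reached. -/
theorem tight_inner (hS : D.Stage (S + 1)) {u v : V} (h : G.Adj u v) (hm : ¬ M.Adj u v)
    (hs : D.slack (S + 1) u v = 0) (hb : 2 * S ≤ D.ten u) (hO : D.O u ≤ S) :
    ¬ D.Sim S u v ∧ D.O u = D.E v + 1 ∧ D.O u < D.E u := by
  have hcap := hS.cap
  have h1 := D.E_even (v := u)
  have h2 := D.O_odd (v := u)
  have hEu : S < D.E u := by unfold ten at hb; omega
  have hns : ¬ D.Sim S u v := fun hsim => by
    have := base_outer hS.matching (by have := hS.cap; omega) hsim h.ne hb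
    omega
  rw [slack_of_not_sim hns] at hs
  have := D.O_le_or_E_le h hm
  have hodd := ten_odd (D := D) (v := u)
  unfold kap at hs
  unfold ten at hb hodd
  refine ⟨hns, ?_, by omega⟩
  omega

theorem Tight.adj_step {x : ℕ → V} {m j : ℕ} (h : D.Tight (S + 1) x m) (hj : Even j)
    (hjm : j + 2 ≤ m) : G.Adj (x j) (x (j + 1)) ∧ ¬ M.Adj (x j) (x (j + 1)) ∧
      M.Adj (x (j + 1)) (x (j + 2)) :=
  ⟨h.alt.adj j (by omega),
    fun h' => Nat.not_even_iff_odd.2 ((h.alt.mem_iff j (by omega)).1 h') hj,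
    (h.alt.mem_iff (j + 1) (by omega)).2 hj.add_one⟩

theorem O_mate_le (hS : D.Stage (S + 1)) {w z : V} (h : M.Adj w z) (hE : D.E w ≤ S) :
    D.O z < D.E w := by
  have h1 := D.E_mate hS.matching h
  have := hS.cap
  omega

theorem Down.succ (hS : D.Stage (S + 1)) {x : ℕ → V} {m j : ℕ} (h : D.Tight (S + 1) x m)
    (hj : Even j) (hjm : j + 2 ≤ m) (hd : D.Down S x j) : D.Down S x (j + 2) := by
  obtain ⟨hadj, hnm, hmz⟩ := h.adj_step hj hjm
  obtain ⟨hs, hex⟩ := h.step hS hj hjm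
  have hexS := hex S (by omega)
  have hmate := ten_mate (D := D) hS.matching (s := S) (by have := hS.cap; omega) hmz
  unfold excess at hexS
  rcases hd with ⟨hb, hO⟩ | ha
  · obtain ⟨hns, hOE, -⟩ := tight_inner hS hadj hnm hs hb hO
    rw [ind_of_not hns, ind_of_not (not_away_of_base hb)] at hexS
    rcases ind_eq (p := D.ten (x (j + 1)) < 2 * S) with ⟨hw, ew⟩ | ⟨hw, ew⟩
    · right
      rcases ind_eq (p := D.Away S x (j + 2)) with h' | h'
      · exact h'.1
      · omega
    · left
      have := O_mate_le hS hmz (by omega)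
      exact ⟨by omega, by omega⟩
  · rw [ind_of ha] at hexS
    rcases ind_eq (p := D.ten (x (j + 1)) < 2 * S) with ⟨hw, ew⟩ | ⟨hw, ew⟩
    · right
      rcases ind_eq (p := D.Away S x (j + 2)) with h' | h'
      · exact h'.1
      · rcases ind_eq (p := D.Sim S (x j) (x (j + 1))) with h'' | h'' <;> omega
    · left
      rw [ew, ind_of_not (not_away_of_base (j := j + 2) (by omega))] at hexS
      rcases ind_eq (p := D.Sim S (x j) (x (j + 1))) with ⟨hsim, es⟩ | ⟨hsim, es⟩
      · have := (base_outer hS.matching (by have := hS.cap; omega) hsim.symm hadj.ne' (by omega)).1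
        have := O_mate_le hS hmz this
        exact ⟨by omega, by omega⟩
      · omega

theorem Down.of_le (hS : D.Stage (S + 1)) {x : ℕ → V} {m j k : ℕ} (h : D.Tight (S + 1) x m)
    (hj : Even j) (hk : Even k) (hjk : j ≤ k) (hkm : k ≤ m) (hd : D.Down S x j) :
    D.Down S x k := by
  obtain ⟨a, rfl⟩ := hj.two_dvd
  obtain ⟨b, rfl⟩ := hk.two_dvd
  obtain ⟨c, rfl⟩ := Nat.exists_eq_add_of_le (show a ≤ b by omega)
  clear hjk hk
  induction c with
  | zero => exact hd
  | succ c ih => exact (ih (by omega)).succ hS h (even_two_mul _) (by omega)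

/-- A tight path never rises after it has started to fall. -/
theorem Up.of_le (hS : D.Stage (S + 1)) {x : ℕ → V} {m j k : ℕ} (h : D.Tight (S + 1) x m)
    (hj : Even j) (hk : Even k) (hjk : j ≤ k) (hkm : k ≤ m) (hu : D.Up S x k) : D.Up S x j := by
  rcases phase_cases hS x j with h' | h' | ⟨hb, hE, hO⟩
  · exact h'
  · exact absurd (Down.of_le hS h hj hk hjk hkm h') (hu.not_down hS)
  · rcases hjk.lt_or_eq with hlt | rfl
    · have hjm : j + 2 ≤ m := by
        have := Nat.even_iff.1 hj; have := Nat.even_iff.1 hk; omega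
      obtain ⟨hadj, hnm, hmz⟩ := h.adj_step hj hjm
      exact absurd (not_tight_of_late hS hadj hnm (h.step hS hj hjm).1 hb hE) (by omega)
    · exact absurd (hu.E_le hS hb) (by omega)

/-- An even path that enters every blossom through its base, rises along the bases it meets, and
whose unmatched edges between different blossoms are tight. -/
structure UpPath (D : Levels M L) (S : ℕ) (x : ℕ → V) (n : ℕ) : Prop where
  alt : Alt M x n
  even : Even n
  block : ∀ k ≤ n, ∃ i ≤ k, 2 * S ≤ D.ten (x i) ∧ ∀ l, i ≤ l → l ≤ k → D.Sim S (x l) (x k)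
  level : ∀ k ≤ n, Even k → 2 * S ≤ D.ten (x k) → D.E (x k) = k ∧ k ≤ S
  rise : ∀ k < n, Even k → ¬ D.Sim S (x k) (x (k + 1)) →
    D.E (x k) + D.kap (S + 1) (x (k + 1)) = 2 * S

theorem UpPath.mono {x : ℕ → V} {n m : ℕ} (h : D.UpPath S x n) (hm : m ≤ n) (he : Even m) :
    D.UpPath S x m where
  alt := h.alt.mono hm
  even := he
  block k hk := h.block k (hk.trans hm)
  level k hk := h.level k (hk.trans hm)
  rise k hk := h.rise k (by omega)

theorem UpPath.of_tight (hS : D.Stage (S + 1)) {x : ℕ → V} {m : ℕ} (h : D.Tight (S + 1) x m)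
    (hu : D.Up S x m) : D.UpPath S x m := by
  have hall : ∀ j ≤ m, Even j → D.Up S x j := fun j hj he => hu.of_le hS h he h.even hj le_rfl
  have hcap := hS.cap
  have hG := hS.good S (by omega)
  -- A double step stays in the current blossom, or else its middle vertex and its end are bases.
  have hblock : ∀ a, 2 * a ≤ m →
      (∃ i ≤ 2 * a, 2 * S ≤ D.ten (x i) ∧ ∀ l, i ≤ l → l ≤ 2 * a → D.Sim S (x l) (x (2 * a))) ∧
      (2 * a + 1 ≤ m → ∃ i ≤ 2 * a + 1, 2 * S ≤ D.ten (x i) ∧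
        ∀ l, i ≤ l → l ≤ 2 * a + 1 → D.Sim S (x l) (x (2 * a + 1))) := by
    have hodd : ∀ a, 2 * a + 2 ≤ m → 2 * S ≤ D.ten (x (2 * a + 1)) ∨
        (D.ten (x (2 * a + 1)) < 2 * S ∧ D.Sim S (x (2 * a)) (x (2 * a + 1))) := by
      intro a ha
      by_cases hw : D.ten (x (2 * a + 1)) < 2 * S
      · right
        have hex := (h.step hS (even_two_mul a) ha).2 S (by omega)
        unfold excess at hex
        have hna : ¬ D.Away S x (2 * a) := by
          obtain ⟨i, hi, hsim, hb, _⟩ := hall _ (by omega) (even_two_mul a)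
          exact fun ha' => absurd (ha' i hi hsim) (by omega)
        have hna' : ¬ D.Away S x (2 * a + 2) := by
          obtain ⟨i, hi, hsim, hb, _⟩ := hall _ ha (even_two_mul (a + 1))
          exact fun ha' => absurd (ha' i hi hsim) (by omega)
        rw [ind_of hw, ind_of_not hna, ind_of_not hna'] at hex
        rcases ind_eq (p := D.Sim S (x (2 * a)) (x (2 * a + 1))) with h' | h'
        · exact ⟨hw, h'.1⟩
        · omega
      · left; omega
    have hextend : ∀ k i, i ≤ k → 2 * S ≤ D.ten (x i) →
        (∀ l, i ≤ l → l ≤ k → D.Sim S (x l) (x k)) → D.Sim S (x k) (x (k + 1)) →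
        ∃ i ≤ k + 1, 2 * S ≤ D.ten (x i) ∧
          ∀ l, i ≤ l → l ≤ k + 1 → D.Sim S (x l) (x (k + 1)) := by
      intro k i hik hb hl hsim
      refine ⟨i, by omega, hb, fun l h1 h2 => ?_⟩
      rcases h2.lt_or_eq with h3 | rfl
      · exact (hl l h1 (by omega)).trans hsim
      · exact Sim.refl _
    have hself : ∀ k, 2 * S ≤ D.ten (x k) → ∃ i ≤ k, 2 * S ≤ D.ten (x i) ∧
          ∀ l, i ≤ l → l ≤ k → D.Sim S (x l) (x k) := fun k hb =>
      ⟨k, le_rfl, hb, fun l h1 h2 => by rw [le_antisymm h2 h1]; exact Sim.refl _⟩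
    have hnext : ∀ a, 2 * a + 1 ≤ m → (∃ i ≤ 2 * a, 2 * S ≤ D.ten (x i) ∧
        ∀ l, i ≤ l → l ≤ 2 * a → D.Sim S (x l) (x (2 * a))) → ∃ i ≤ 2 * a + 1,
        2 * S ≤ D.ten (x i) ∧ ∀ l, i ≤ l → l ≤ 2 * a + 1 → D.Sim S (x l) (x (2 * a + 1)) := by
      intro a ha hblk
      have ha' : 2 * a + 2 ≤ m := by have := Nat.even_iff.1 h.even; omega
      rcases hodd a ha' with hw | ⟨hw, hsim⟩
      · exact hself _ hw
      · obtain ⟨i, hi, hb, hl⟩ := hblk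
        exact hextend _ i hi hb hl hsim
    intro a
    induction a with
    | zero =>
      intro _
      have h0 : ∃ i ≤ 2 * 0, 2 * S ≤ D.ten (x i) ∧
          ∀ l, i ≤ l → l ≤ 2 * 0 → D.Sim S (x l) (x (2 * 0)) := hself _ (by
        have := hS.O_free _ h.alt.free; unfold ten; simp only [Nat.mul_zero]; omega)
      exact ⟨h0, fun h1 => hnext 0 h1 h0⟩
    | succ a ih =>
      intro ha
      obtain ⟨h0, h1⟩ := ih (by omega)
      have hmz := (h.adj_step (even_two_mul a) ha).2.2
      have hmate := ten_mate (D := D) hS.matching (s := S) (by omega) hmz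
      have h2 : ∃ i ≤ 2 * (a + 1), 2 * S ≤ D.ten (x i) ∧
          ∀ l, i ≤ l → l ≤ 2 * (a + 1) → D.Sim S (x l) (x (2 * (a + 1))) := by
        rcases hodd a ha with hw | ⟨hw, hsim⟩
        · exact hself _ (by have : 2 * (a + 1) = 2 * a + 2 := by ring
                            rw [this]; omega)
        · obtain ⟨i, hi, hb, hl⟩ := h1 (by omega)
          exact hextend _ i hi hb hl (sim_of_matched hS.matching (by omega) hmz hw)
      exact ⟨h2, fun h3 => hnext _ h3 h2⟩
  have hlev : ∀ k ≤ m, Even k → 2 * S ≤ D.ten (x k) → D.E (x k) = k ∧ k ≤ S := by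
    intro k hk he hb
    have h1 := (hall k hk he).E_le hS hb
    have h2 := h.kap_base he hk (by simpa using hb)
    rw [kap_of_E_le (by omega)] at h2
    omega
  refine ⟨h.alt, h.even, fun k hk => ?_, hlev, fun k hk he hns => ?_⟩
  · rcases Nat.even_or_odd' k with ⟨a, rfl | rfl⟩
    · exact (hblock a hk).1
    · exact (hblock a (by omega)).2 hk
  · have hk2 : k + 2 ≤ m := by
      have := Nat.even_iff.1 h.even; have := Nat.even_iff.1 he; omega
    have h1 := (h.step hS he hk2).1
    rw [slack_of_not_sim hns] at h1
    have : D.kap (S + 1) (x k) = D.E (x k) := by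
      rcases Nat.lt_or_ge (D.ten (x k)) (2 * S) with h' | h'
      · exact kap_of_ten_le (by omega)
      · exact kap_of_E_le (by have := hlev k hk.le he h'; omega)
    omega

theorem UpPath.of_even (hS : D.Stage (S + 1)) {x : ℕ → V} {n : ℕ} (hx : Alt M x n) (hn : Even n)
    (hE : D.E (x n) = n) (h : D.ten (x n) < 2 * S ∨ n ≤ S) : D.UpPath S x n := by
  have hk : D.kap (S + 1) (x n) = D.E (x n) := by
    rcases h with h | h
    · exact kap_of_ten_le (by omega)
    · exact kap_of_E_le (by omega)
  obtain ⟨ht, hna⟩ := tight_of_even hS hx hn hE hk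
  refine .of_tight hS ht ?_
  obtain ⟨i, hi, hsim, hb⟩ := exists_base_of_not_away (hna S (by omega))
  refine ⟨i, hi, hsim, hb, ?_⟩
  by_cases heq : x i = x n
  · rw [heq] at hb ⊢; omega
  · exact (base_outer hS.matching (by have := hS.cap; omega) hsim heq hb).1

theorem exists_upPath (hS : D.Stage (S + 1)) {v : V} (h : D.ten v < 2 * S ∨ D.E v ≤ S) :
    ∃ x, D.UpPath S x (D.E v) ∧ x (D.E v) = v := by
  have hL : D.E v < L := by have := hS.cap; unfold ten at h; omega
  obtain ⟨he, x, hx, hv⟩ := D.E_att v hL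
  exact ⟨x, .of_even hS hx he (by rw [hv]) (by rw [hv]; omega), hv⟩

end Levels

/-! ### Splicing alternating paths -/

/-- Exchanging the initial segment of a path. -/
theorem Alt.splice {p r : ℕ → V} {c k : ℕ} (hp : Alt M p c) (hr : Alt M r k) (hck : c ≤ k)
    (hc : p c = r c) (hdis : ∀ i ≤ c, ∀ l, c < l → l ≤ k → p i ≠ r l) :
    Alt M (fun i => if i ≤ c then p i else r i) k := by
  have hstep : ∀ i < k, (i < c ∧ (if i ≤ c then p i else r i) = p i ∧
      (if i + 1 ≤ c then p (i + 1) else r (i + 1)) = p (i + 1)) ∨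
      ((if i ≤ c then p i else r i) = r i ∧
      (if i + 1 ≤ c then p (i + 1) else r (i + 1)) = r (i + 1)) := by
    intro i _
    rcases lt_trichotomy i c with h | rfl | h
    · exact Or.inl ⟨h, if_pos h.le, if_pos h⟩
    · exact Or.inr ⟨by rw [if_pos le_rfl, hc], if_neg (by omega)⟩
    · exact Or.inr ⟨if_neg (by omega), if_neg (by omega)⟩
  refine ⟨by simpa using hp.free, fun i hi => ?_, fun i hi => ?_, fun i hi j hj hij => ?_⟩
  · rcases hstep i hi with ⟨h, h1, h2⟩ | ⟨h1, h2⟩ <;> simp only [h1, h2]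
    · exact hp.adj i h
    · exact hr.adj i hi
  · rcases hstep i hi with ⟨h, h1, h2⟩ | ⟨h1, h2⟩ <;> simp only [h1, h2]
    · exact hp.mem_iff i h
    · exact hr.mem_iff i hi
  · split_ifs at hij with h1 h2 h2
    · exact hp.inj i h1 j h2 hij
    · exact absurd hij (hdis i h1 j (by omega) hj)
    · exact absurd hij.symm (hdis j h2 i (by omega) hi)
    · exact hr.inj i hi j hj hij

namespace Levels

variable {D : Levels M L}

/-- Two disjoint even paths whose ends are joined by an unmatched edge bound the odd level of the
vertices of one of them. -/
theorem O_le_of_join {q r : ℕ → V} {a b i : ℕ} (hq : Alt M q a) (ha : Even a)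
    (hr : Alt M r b) (hb : Even b) (hadj : G.Adj (q a) (r b)) (hm : ¬ M.Adj (q a) (r b))
    (hib : i ≤ b) (hi : Even i) (hdis : ∀ j ≤ a, ∀ l, i ≤ l → l ≤ b → q j ≠ r l) :
    D.O (r i) ≤ a + 1 + (b - i) := by
  have hstep : ∀ l < b - i, b - l = b - (l + 1) + 1 := fun l hl => by omega
  have h := hq.append (d := fun l => r (b - l)) (b := b - i) (by simpa using hadj)
    (by simpa using ⟨fun h => absurd h hm, fun h => absurd ha (Nat.not_even_iff_odd.2 h)⟩)
    (fun l hl => by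
      have := (hr.adj (b - (l + 1)) (by omega)).symm
      rwa [← hstep l hl] at this)
    (fun l hl => by
      have := hr.mem_iff (b - (l + 1)) (by omega)
      rw [← hstep l hl, M.adj_comm] at this
      rw [this]
      simp only [Nat.odd_iff, Nat.even_iff] at *
      omega)
    (fun l hl l' hl' hll => by
      have := hr.inj _ (by omega) _ (by omega) hll
      omega)
    (fun j hj l hl => hdis j hj _ (by omega) (by omega))
  have h' := D.O_le _ _ h (by simp only [Nat.odd_iff, Nat.even_iff] at *; omega)
  rwa [joinAt_add, show b - (b - i) = i by omega] at h'

/-! ### The last vertex of high tenacity -/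

/-- `K` is the last vertex of tenacity at least `2 * S + 2` on the path of length `n`. -/
def LastHigh (D : Levels M L) (S : ℕ) (x : ℕ → V) (n : ℕ) (K : V) : Prop :=
  ∃ i ≤ n, x i = K ∧ 2 * S + 2 ≤ D.ten K ∧ ∀ l, i < l → l ≤ n → D.ten (x l) < 2 * S + 2

theorem exists_lastHigh {x : ℕ → V} (h : 2 * S + 2 ≤ D.ten (x 0)) (n : ℕ) :
    ∃ K, D.LastHigh S x n K := by
  induction n with
  | zero => exact ⟨x 0, 0, le_rfl, rfl, h, fun l h1 h2 => by omega⟩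
  | succ n ih =>
    by_cases hn : 2 * S + 2 ≤ D.ten (x (n + 1))
    · exact ⟨_, n + 1, le_rfl, rfl, hn, fun l h1 h2 => by omega⟩
    · obtain ⟨K, i, hi, hK, hh, hl⟩ := ih
      refine ⟨K, i, by omega, hK, hh, fun l h1 h2 => ?_⟩
      rcases h2.lt_or_eq with h3 | rfl
      · exact hl l h1 (by omega)
      · omega

theorem LastHigh.unique {x : ℕ → V} {n : ℕ} {K K' : V} (h : D.LastHigh S x n K)
    (h' : D.LastHigh S x n K') : K = K' := by
  obtain ⟨i, hi, rfl, hh, hl⟩ := h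
  obtain ⟨j, hj, rfl, hh', hl'⟩ := h'
  rcases lt_trichotomy i j with h | rfl | h
  · exact absurd (hl j h hj) (by omega)
  · rfl
  · exact absurd (hl' i h hi) (by omega)

theorem lastHigh_self {x : ℕ → V} {n : ℕ} (h : 2 * S + 2 ≤ D.ten (x n)) :
    D.LastHigh S x n (x n) := ⟨n, le_rfl, rfl, h, fun l h1 h2 => by omega⟩

theorem lastHigh_iff {x : ℕ → V} {n m : ℕ} {K : V} (hmn : m ≤ n)
    (hl : ∀ l, m < l → l ≤ n → D.ten (x l) < 2 * S + 2) :
    D.LastHigh S x n K ↔ D.LastHigh S x m K := by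
  constructor
  · rintro ⟨i, hi, rfl, hh, h⟩
    refine ⟨i, ?_, rfl, hh, fun l h1 h2 => h l h1 (by omega)⟩
    by_contra hc
    exact absurd (hl i (by omega) hi) (by omega)
  · rintro ⟨i, hi, rfl, hh, h⟩
    refine ⟨i, by omega, rfl, hh, fun l h1 h2 => ?_⟩
    rcases Nat.lt_or_ge m l with h3 | h3
    · exact hl l h3 h2
    · exact h l h1 h3

theorem lastHigh_congr {x y : ℕ → V} {n : ℕ} {K : V} (h : ∀ i ≤ n, x i = y i) :
    D.LastHigh S x n K → D.LastHigh S y n K := by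
  rintro ⟨i, hi, rfl, hh, hl⟩
  exact ⟨i, hi, (h i hi).symm, hh, fun l h1 h2 => h l h2 ▸ hl l h1 h2⟩

/-! ### Common bases of rising paths -/

theorem UpPath.base_mem (hS : D.Stage (S + 1)) {r : ℕ → V} {k j : ℕ} (hr : D.UpPath S r k)
    (hj : j ≤ k) (hb : 2 * S ≤ D.ten (r j)) :
    (Even j ∧ D.E (r j) = j ∧ j ≤ S ∧ S < D.O (r j)) ∨
    (Odd j ∧ j + 1 ≤ k ∧ j + 1 ≤ S ∧ D.O (r j) = j ∧ S < D.E (r j) ∧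
      M.Adj (r j) (r (j + 1))) := by
  have hcap := hS.cap
  rcases Nat.even_or_odd j with he | ho
  · have := hr.level j hj he hb
    refine Or.inl ⟨he, this.1, this.2, ?_⟩
    have h2 := D.E_even (v := r j)
    have h3 := D.O_odd (v := r j)
    unfold ten at hb
    omega
  · have hjk : j + 1 ≤ k := by
      have := Nat.odd_iff.1 ho; have := Nat.even_iff.1 hr.even; omega
    have hm := (hr.alt.mem_iff j (by omega)).2 ho
    have hb' := ten_mate (D := D) hS.matching (s := S) (by omega) hm
    have hl := hr.level (j + 1) hjk ho.add_one (by omega)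
    have h1 := D.E_mate hS.matching hm.symm
    have h2 := D.E_even (v := r j)
    have h3 := D.O_odd (v := r j)
    refine Or.inr ⟨ho, hjk, hl.2, by omega, ?_, hm⟩
    unfold ten at hb
    omega

theorem UpPath.sim_of_between (hS : D.Stage (S + 1)) {p : ℕ → V} {m c j : ℕ}
    (hp : D.UpPath S p m) (hj : j ≤ m) (hcm : c ≤ m) (hb : 2 * S ≤ D.ten (p c))
    (hsim : D.Sim S (p j) (p c)) : c ≤ j ∧ ∀ i, c ≤ i → i ≤ j → D.Sim S (p i) (p c) := by
  obtain ⟨i, hij, hbi, hl⟩ := hp.block j hj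
  have := hp.alt.inj _ (by omega) _ hcm
    ((hS.good S (by omega)).unique _ _ ((hl i le_rfl hij).trans hsim) hbi hb)
  subst this
  exact ⟨hij, fun l h1 h2 => (hl l h1 h2).trans hsim⟩

/-- Two rising paths are disjoint, or they have a last common base `c`, at the same index in both;
they then can meet again only inside the blossom of `c`. -/
theorem UpPath.inter (hS : D.Stage (S + 1)) {p r : ℕ → V} {m k : ℕ} (hp : D.UpPath S p m)
    (hr : D.UpPath S r k) :
    (∀ i ≤ k, ∀ j ≤ m, r i ≠ p j) ∨
    ∃ c ≤ k, c ≤ m ∧ Even c ∧ p c = r c ∧ 2 * S ≤ D.ten (p c) ∧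
      ∀ l, c < l → l ≤ k → ∀ j ≤ m, r l = p j → D.Sim S (r l) (r c) ∧ c < j := by
  classical
  have hcap := hS.cap
  have hG := hS.good S (by omega)
  have hbase : ∀ l ≤ k, ∀ j ≤ m, r l = p j → ∃ l' ≤ l, ∃ j' ≤ j, r l' = p j' ∧
      2 * S ≤ D.ten (r l') ∧ (∀ i, l' ≤ i → i ≤ l → D.Sim S (r i) (r l)) := by
    intro l hl j hj hlj
    obtain ⟨l', h1, h2, h3⟩ := hr.block l hl
    obtain ⟨j', h4, h5, h6⟩ := hp.block j hj
    refine ⟨l', h1, j', h4, hG.unique _ _ ?_ h2 h5, h2, h3⟩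
    exact (h3 l' le_rfl h1).trans (hlj ▸ (h6 j' le_rfl h4).symm)
  by_cases hex : ∃ i ≤ k, 2 * S ≤ D.ten (r i) ∧ ∃ j ≤ m, r i = p j
  swap
  · left
    intro i hi j hj hij
    obtain ⟨l', h1, j', h2, h3, h4, _⟩ := hbase i hi j hj hij
    exact hex ⟨l', by omega, h4, j', by omega, h3⟩
  right
  obtain ⟨c, ⟨hck, hcb, j, hj, hcj⟩, hmax⟩ : ∃ c, (c ≤ k ∧ 2 * S ≤ D.ten (r c) ∧
      ∃ j ≤ m, r c = p j) ∧ ∀ l, c < l → ¬ (l ≤ k ∧ 2 * S ≤ D.ten (r l) ∧ ∃ j ≤ m, r l = p j) := by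
    obtain ⟨i, hi, hi'⟩ := hex
    exact ⟨_, Nat.findGreatest_spec (P := fun i => i ≤ k ∧ 2 * S ≤ D.ten (r i) ∧
      ∃ j ≤ m, r i = p j) hi ⟨hi, hi'⟩, fun l hl h =>
        absurd (Nat.le_findGreatest (P := fun i => i ≤ k ∧ 2 * S ≤ D.ten (r i) ∧
          ∃ j ≤ m, r i = p j) h.1 h) (by omega)⟩
  have hce : Even c := by
    by_contra ho
    rw [Nat.not_even_iff_odd] at ho
    have hck' : c + 1 ≤ k := by
      have := Nat.odd_iff.1 ho; have := Nat.even_iff.1 hr.even; omega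
    have hm := (hr.alt.mem_iff c (by omega)).2 ho
    have hb' := ten_mate (D := D) hS.matching (s := S) (by omega) hm
    refine hmax (c + 1) (by omega) ⟨hck', by omega, ?_⟩
    rcases hp.alt.index_of_mate hS.matching hj (w := r (c + 1)) (hcj ▸ hm) with
      ⟨hjo, h1⟩ | ⟨-, -, h1⟩
    · have hjm : j < m := by
        have := Nat.odd_iff.1 hjo; have := Nat.even_iff.1 hp.even; omega
      exact ⟨j + 1, hjm, (h1 hjm).symm⟩
    · exact ⟨j - 1, by omega, h1.symm⟩
  have hjc : j = c := by
    rcases hr.base_mem hS hck hcb with ⟨-, h1, h2, h3⟩ | ⟨h, -⟩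
    · rcases hp.base_mem hS hj (hcj ▸ hcb) with ⟨-, h4, -⟩ | ⟨-, -, -, -, h4, -⟩
      · rw [hcj] at h1; omega
      · rw [hcj] at h1; omega
    · exact absurd hce (Nat.not_even_iff_odd.2 h)
  subst hjc
  refine ⟨j, hck, hj, hce, hcj.symm, hcj ▸ hcb, fun l hl hlk i hi hli => ?_⟩
  obtain ⟨l', h1, i', h2, h3, h4, h5⟩ := hbase l hlk i hi hli
  have hl' : l' ≤ j := by
    by_contra hc
    exact hmax l' (by omega) ⟨by omega, h4, i', by omega, h3⟩
  have hsim := (h5 j hl' hl.le).symm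
  refine ⟨hsim, lt_of_le_of_ne ?_ ?_⟩
  · exact (hp.sim_of_between hS hi hj (hcj ▸ hcb) (by rw [← hli, ← hcj]; exact hsim)).1
  · rintro rfl
    have := hr.alt.inj _ hlk _ hck (hli.trans hcj.symm)
    omega

theorem UpPath.lastHigh_even (hS : D.Stage (S + 1)) {x : ℕ → V} {n : ℕ} {K : V}
    (hx : D.UpPath S x n) (h : D.LastHigh S x n K) :
    ∃ i ≤ n, Even i ∧ x i = K ∧ D.E K = i ∧ 2 * S + 2 ≤ D.ten K ∧
      ∀ l, i < l → l ≤ n → D.ten (x l) < 2 * S + 2 := by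
  obtain ⟨i, hi, rfl, hh, hl⟩ := h
  rcases hx.base_mem hS hi (by omega) with ⟨h1, h2, -⟩ | ⟨h1, h2, -, -, -, hm⟩
  · exact ⟨i, hi, h1, rfl, h2, hh, hl⟩
  · have := ten_mate (D := D) hS.matching (s := S + 1) hS.cap.le hm
    have := hl (i + 1) (by omega) h2
    omega

/-- Two rising paths, the first of them prolonged to `p n`, whose ends are joined by
an unmatched edge and whose lengths add up to `2 * S`, have the same last vertex of high tenacity:
otherwise one of the two last high vertices could be reached by a short odd path that runs along the
other path, across the edge, and back down. -/
theorem fork (hS : D.Stage (S + 1)) (hF : ∀ f ∉ M.verts, 2 * S + 2 ≤ D.O f) {p r : ℕ → V}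
    {m n k : ℕ} {K : V} (hp : D.UpPath S p m) (hr : D.UpPath S r k) (hpa : Alt M p n)
    (hn : Even n) (hmn : m ≤ n) (hadj : G.Adj (p n) (r k)) (hm : ¬ M.Adj (p n) (r k))
    (hdis : ∀ i, m < i → i ≤ n → ∀ j ≤ k, p i ≠ r j) (hlen : n + k = 2 * S)
    (hA : ∀ c ≤ m, c ≤ k → Even c → p c = r c → 2 * S ≤ D.ten (p c) → ∀ K K',
      D.LastHigh S p c K → D.LastHigh S r c K' → K = K')
    (hK : D.LastHigh S p m K) : D.LastHigh S r k K := by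
  have hhigh : ∀ x : ℕ → V, x 0 ∉ M.verts → 2 * S + 2 ≤ D.ten (x 0) := fun x hx => by
    have := hF _ hx; unfold ten; omega
  obtain ⟨i, him, hie, hiK, hEK, hten, hafter⟩ := hp.lastHigh_even hS hK
  have hG := hS.good S (by omega)
  -- No even path of length `k` to `r k` can avoid the part of `p` from `K` on.
  have hclaim : ∀ q : ℕ → V, Alt M q k → q k = r k →
      (∀ j ≤ k, ∀ l, i ≤ l → l ≤ n → q j ≠ p l) → False := by
    intro q hq hqk hd
    have := O_le_of_join (D := D) hq hr.even hpa hn (by rw [hqk]; exact hadj.symm)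
      (by rw [hqk]; exact fun h => hm h.symm) (by omega) hie hd
    rw [hiK] at this
    unfold ten at hten
    omega
  rcases hp.inter hS hr with hno | ⟨c, hck, hcm, hce, hpc, hcb, hmeet⟩
  · refine (hclaim r hr.alt rfl fun j hj l h1 h2 => ?_).elim
    rcases Nat.lt_or_ge m l with h3 | h3
    · exact (hdis l h3 h2 j hj).symm
    · exact hno j hj l h3
  rcases Nat.lt_or_ge c i with hci | hic
  · refine (hclaim _ ((hpa.mono (by omega)).splice hr.alt hck hpc ?_) ?_ ?_).elim
    · intro a ha l h1 h2 hal
      have := (hmeet l h1 h2 a (by omega) hal.symm).2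
      omega
    · split_ifs with h
      · rw [le_antisymm h hck, hpc]
      · rfl
    · intro j hj l h1 h2
      split_ifs with h
      · exact fun h' => absurd (hpa.inj _ (by omega) _ h2 h') (by omega)
      · rcases Nat.lt_or_ge m l with h3 | h3
        · exact (hdis l h3 h2 j hj).symm
        · intro h'
          have hsim := (hmeet j (by omega) hj l h3 h').1
          rw [h', ← hpc] at hsim
          have := (hp.sim_of_between hS h3 hcm hcb hsim).2 i hci.le h1
          have := hp.alt.inj _ him _ hcm (hG.unique _ _ this (by rw [hiK]; omega) hcb)
          omega
  · have hK' : D.LastHigh S p c K := ⟨i, hic, hiK, hten, fun l h1 h2 => hafter l h1 (by omega)⟩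
    obtain ⟨K', hrc⟩ := exists_lastHigh (D := D) (hhigh r hr.alt.free) c
    have hKK := hA c hcm hck hce hpc hcb K K' hK' hrc
    subst hKK
    rw [lastHigh_iff hck]
    · exact hrc
    by_contra hcon
    push Not at hcon
    obtain ⟨l₀, hl₀, hl₀k, hh₀⟩ := hcon
    obtain ⟨K₁, hK₁⟩ := exists_lastHigh (D := D) (hhigh r hr.alt.free) k
    obtain ⟨i₁, hi₁k, hi₁e, hi₁K, hE₁, hten₁, hafter₁⟩ := hr.lastHigh_even hS hK₁
    have hci₁ : c < i₁ := by
      by_contra hc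
      exact absurd (hafter₁ l₀ (by omega) hl₀k) (by omega)
    have := O_le_of_join (D := D) hpa hn hr.alt hr.even hadj hm hi₁k hi₁e (by
      intro j hj l h1 h2 hjl
      rcases Nat.lt_or_ge m j with h3 | h3
      · exact hdis j h3 hj l h2 hjl
      · have hsim := (hmeet l (by omega) h2 j h3 hjl.symm).1
        have := (hr.sim_of_between hS h2 hck (hpc ▸ hcb) hsim).2 i₁ hci₁.le h1
        have := hr.alt.inj _ hi₁k _ hck (hG.unique _ _ this (by rw [hi₁K]; omega) (hpc ▸ hcb))
        omega)
    rw [hi₁K] at this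
    unfold ten at hten₁
    omega

end Levels

theorem Alt.snoc_two {r : ℕ → V} {k : ℕ} {b z : V} (hr : Alt M r k) (hk : Even k)
    (hadj : G.Adj (r k) b) (hm : ¬ M.Adj (r k) b) (hbz : M.Adj b z) (hb : ∀ i ≤ k, r i ≠ b)
    (hz : ∀ i ≤ k, r i ≠ z) :
    ∃ g, Alt M g (k + 2) ∧ (∀ i ≤ k, g i = r i) ∧ g (k + 1) = b ∧ g (k + 2) = z := by
  have h1 := hr.snoc (w := b) hadj
    ⟨fun h => absurd h hm, fun h => absurd hk (Nat.not_even_iff_odd.2 h)⟩ hb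
  have h2 := h1.snoc (w := z) (by rw [joinAt_succ]; exact M.adj_sub hbz)
    (by rw [joinAt_succ]; exact ⟨fun _ => hk.add_one, fun _ => hbz⟩) (by
      intro i hi
      rcases hi.lt_or_eq with h | rfl
      · rw [joinAt_of_le (by omega)]; exact hz i (by omega)
      · rw [joinAt_succ]; exact (M.adj_sub hbz).ne)
  refine ⟨_, h2, fun i hi => ?_, ?_, joinAt_succ⟩
  · rw [joinAt_of_le (by omega), joinAt_of_le hi]
  · rw [joinAt_of_le le_rfl, joinAt_succ]

namespace Levels

variable {D : Levels M L}

/-! ### The turning point of a tight path -/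

theorem Tight.O_le_of_lt (hS : D.Stage (S + 1)) {x : ℕ → V} {n j : ℕ} (h : D.Tight (S + 1) x n)
    (hj : Even j) (hjn : j < n) (hb : 2 * S ≤ D.ten (x j)) (hE : S < D.E (x j)) :
    D.O (x j) ≤ S := by
  have hjm : j + 2 ≤ n := by
    have := Nat.even_iff.1 hj; have := Nat.even_iff.1 h.even; omega
  obtain ⟨hadj, hnm, -⟩ := h.adj_step hj hjm
  exact not_tight_of_late hS hadj hnm (h.step hS hj hjm).1 hb hE

/-- A tight path rises up to some index `m` and falls from there on. -/
theorem Tight.exists_turn (hS : D.Stage (S + 1)) {x : ℕ → V} {n : ℕ} (h : D.Tight (S + 1) x n)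
    (hlast : 2 * S ≤ D.ten (x n) → S < D.E (x n) → D.O (x n) ≤ S) :
    ∃ m ≤ n, Even m ∧ D.Up S x m ∧ ∀ j, m < j → j ≤ n → Even j → D.Down S x j := by
  classical
  have h0 : Even 0 ∧ D.Up S x 0 := ⟨Even.zero, 0, le_rfl, Sim.refl _, by
    have := hS.O_free _ h.alt.free; unfold ten; omega, by rw [D.E_free h.alt.free]; omega⟩
  refine ⟨Nat.findGreatest (fun j => Even j ∧ D.Up S x j) n, Nat.findGreatest_le _,
    (Nat.findGreatest_spec (P := fun j => Even j ∧ D.Up S x j) (Nat.zero_le n) h0).1,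
    (Nat.findGreatest_spec (P := fun j => Even j ∧ D.Up S x j) (Nat.zero_le n) h0).2,
    fun j hj hjn hje => ?_⟩
  rcases phase_cases hS x j with hu | hd | ⟨hb, hE, hO⟩
  · exact absurd (Nat.le_findGreatest (P := fun j => Even j ∧ D.Up S x j) hjn ⟨hje, hu⟩) (by omega)
  · exact hd
  · rcases hjn.lt_or_eq with hlt | rfl
    · exact absurd (h.O_le_of_lt hS hje hlt hb hE) (by omega)
    · exact absurd (hlast hb hE) (by omega)

/-- A path that has entered a blossom elsewhere than through its base leaves the blossom through
its base. -/
theorem Tight.exists_base_after (hS : D.Stage (S + 1)) {x : ℕ → V} {n : ℕ}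
    (h : D.Tight (S + 1) x n) (hb : 2 * S ≤ D.ten (x (n + 1)))
    (hlast : D.Away S x n ↔ D.Sim S (x n) (x (n + 1))) (a : ℕ) :
    ∀ j, j + 2 * a = n → D.Away S x j →
      ∃ l, j < l ∧ l ≤ n + 1 ∧ 2 * S ≤ D.ten (x l) ∧ D.Sim S (x l) (x j) := by
  induction a with
  | zero =>
    rintro j rfl ha
    exact ⟨_, Nat.lt_succ_self _, le_rfl, hb, (hlast.1 ha).symm⟩
  | succ a ih =>
    intro j hj ha
    have he : Even j := by
      have := h.even; simp only [Nat.even_iff] at *; omega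
    obtain ⟨hadj, hnm, hmz⟩ := h.adj_step he (by omega)
    have hex := (h.step hS he (by omega)).2 S (by omega)
    have hmate := ten_mate (D := D) hS.matching (s := S) (by have := hS.cap; omega) hmz
    unfold excess at hex
    rw [ind_of ha] at hex
    rcases ind_eq (p := D.Sim S (x j) (x (j + 1))) with ⟨hsim, es⟩ | ⟨hsim, es⟩
    · by_cases hw : D.ten (x (j + 1)) < 2 * S
      · have ha' : D.Away S x (j + 2) := by
          rw [ind_of hw] at hex
          rcases ind_eq (p := D.Away S x (j + 2)) with h' | h'
          · exact h'.1
          · omega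
        obtain ⟨l, h1, h2, h3, h4⟩ := ih (j + 2) (by omega) ha'
        exact ⟨l, by omega, h2, h3, h4.trans
          (hsim.trans (sim_of_matched hS.matching (by have := hS.cap; omega) hmz hw)).symm⟩
      · exact ⟨j + 1, by omega, by omega, by omega, hsim.symm⟩
    · rcases ind_eq (p := D.Away S x (j + 2)) with ⟨ha', h'⟩ | ⟨ha', h'⟩
      · by_cases hw : D.ten (x (j + 1)) < 2 * S
        · rw [ind_of hw] at hex; omega
        · exact absurd ha' (not_away_of_base (by omega))
      · have := ind_nonneg (D.ten (x (j + 1)) < 2 * S); omega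

/-- The falling part of a shortest odd path to a base `N` does not meet a rising path to `N`: the
blossoms met by the former lie at higher levels than `N`. -/
theorem fall_disjoint (hS : D.Stage (S + 1)) {p r : ℕ → V} {m n k : ℕ}
    (ht : D.Tight (S + 1) p n) (hpa : Alt M p (n + 1)) (hb : 2 * S ≤ D.ten (p (n + 1)))
    (hlast : D.Away S p n ↔ D.Sim S (p n) (p (n + 1)))
    (hfall : ∀ j, m < j → j ≤ n → Even j → D.Down S p j)
    (hr : D.UpPath S r k) (hrk : r k = p (n + 1)) (hlen : n + k = 2 * S) :
    ∀ i, m < i → i ≤ n → ∀ j ≤ k, p i ≠ r j := by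
  have hcap := hS.cap
  have hne := Nat.even_iff.1 ht.even
  have heven : ∀ i, m < i → i ≤ n → Even i → 2 * S ≤ D.ten (p i) → ∀ j ≤ k, p i ≠ r j := by
    intro i hmi hin hie hib j hj hij
    have hO : D.O (p i) ≤ S := by
      rcases hfall i hmi hin hie with h | h
      · exact h.2
      · exact absurd h (not_away_of_base hib)
    have hk := ht.kap_base hie hin (by simpa using hib)
    rcases hr.base_mem hS hj (hij ▸ hib) with ⟨-, -, -, h3⟩ | ⟨-, h1, h2, h3, h4, -⟩
    · rw [hij] at hO; omega
    · rw [← hij] at h3 h4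
      unfold kap at hk
      unfold ten at hib
      omega
  have hbase : ∀ i, m < i → i ≤ n → 2 * S ≤ D.ten (p i) → ∀ j ≤ k, p i ≠ r j := by
    intro i hmi hin hib j hj hij
    rcases Nat.even_or_odd i with hie | hio
    · exact heven i hmi hin hie hib j hj hij
    · have hin' : i + 1 ≤ n := by have := Nat.odd_iff.1 hio; omega
      have hm := (hpa.mem_iff i (by omega)).2 hio
      have hb' := ten_mate (D := D) hS.matching (s := S) (by omega) hm
      rcases hr.alt.index_of_mate hS.matching hj (w := p (i + 1)) (hij ▸ hm) with
        ⟨hjo, h1⟩ | ⟨-, -, h1⟩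
      · have hjk : j < k := by
          have := Nat.odd_iff.1 hjo; have := Nat.even_iff.1 hr.even; omega
        exact heven (i + 1) (by omega) hin' hio.add_one (by omega) (j + 1) hjk (h1 hjk).symm
      · exact heven (i + 1) (by omega) hin' hio.add_one (by omega) (j - 1) (by omega) h1.symm
  intro i hmi hin j hj hij
  by_cases hib : 2 * S ≤ D.ten (p i)
  · exact hbase i hmi hin hib j hj hij
  have hafter : ∀ i, m < i → i ≤ n → Even i → D.ten (p i) < 2 * S →
      ∃ l, i < l ∧ l ≤ n + 1 ∧ 2 * S ≤ D.ten (p l) ∧ D.Sim S (p l) (p i) := by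
    intro i hmi hin hie hib
    have ha : D.Away S p i := by
      rcases hfall i hmi hin hie with h | h
      · omega
      · exact h
    have := Nat.even_iff.1 hie
    exact ht.exists_base_after hS hb hlast ((n - i) / 2) i (by omega) ha
  obtain ⟨l, hil, hln, hlb, hsim⟩ : ∃ l, i < l ∧ l ≤ n + 1 ∧ 2 * S ≤ D.ten (p l) ∧
      D.Sim S (p l) (p i) := by
    rcases Nat.even_or_odd i with hie | hio
    · exact hafter i hmi hin hie (by omega)
    · have hin' : i + 1 ≤ n := by have := Nat.odd_iff.1 hio; omega
      have hm := (hpa.mem_iff i (by omega)).2 hio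
      have hb' := ten_mate (D := D) hS.matching (s := S) (by omega) hm
      obtain ⟨l, h1, h2, h3, h4⟩ := hafter (i + 1) (by omega) hin' hio.add_one (by omega)
      exact ⟨l, by omega, h2, h3,
        h4.trans (sim_of_matched hS.matching (by omega) hm (by omega)).symm⟩
  obtain ⟨j', hj', hb', hl'⟩ := hr.block j hj
  have heq : p l = r j' := (hS.good S (by omega)).unique _ _
    (hsim.trans (hij ▸ (hl' j' le_rfl hj').symm)) hlb hb'
  rcases hln.lt_or_eq with h | rfl
  · exact hbase l (by omega) (by omega) hlb j' (by omega) heq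
  · have := hr.alt.inj _ le_rfl _ (by omega) (hrk.trans heq)
    have : j = k := by omega
    subst this
    rw [hij, hrk] at hib
    exact hib hb

/-- All rising paths to the same base have the same last vertex of high tenacity. -/
theorem anchor_unique (hS : D.Stage (S + 1)) (hF : ∀ f ∉ M.verts, 2 * S + 2 ≤ D.O f) :
    ∀ (k : ℕ) (r r' : ℕ → V) (K K' : V), D.UpPath S r k → D.UpPath S r' k → r k = r' k →
      2 * S ≤ D.ten (r k) → D.LastHigh S r k K → D.LastHigh S r' k K' → K = K' := by
  intro k
  induction k using Nat.strong_induction_on with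
  | _ k ih =>
  intro r r' K K' hr hr' hrr hb hK hK'
  have hcap := hS.cap
  by_cases hh : 2 * S + 2 ≤ D.ten (r k)
  · rw [hK.unique (lastHigh_self hh), hK'.unique (lastHigh_self (hrr ▸ hh)), hrr]
  have hodd := ten_odd (D := D) (v := r k) (by omega)
  obtain ⟨hEk, hkS⟩ := hr.level k le_rfl hr.even hb
  have hO : D.O (r k) = 2 * S + 1 - k := by unfold ten at *; omega
  obtain ⟨ho, p, hp, hpN⟩ := D.O_att (r k) (by omega)
  obtain ⟨n, hn⟩ : ∃ n, D.O (r k) = n + 1 := ⟨2 * S - k, by omega⟩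
  rw [hn] at hp hpN ho
  have hne : Even n := by simp only [Nat.odd_iff, Nat.even_iff] at *; omega
  have hkap : D.kap (S + 1) (r k) = D.E (r k) := kap_of_E_le (by omega)
  obtain ⟨ht, hsl, haw⟩ := tight_of_odd hS hp hne (by rw [hpN, hkap]; omega)
    (by rw [hpN]; simpa using hb)
  obtain ⟨m, hmn, hme, hum, hfall⟩ := ht.exists_turn hS fun hb' hE =>
    not_tight_of_late hS (hp.adj n (by omega))
      (fun h => Nat.not_even_iff_odd.2 ((hp.mem_iff n (by omega)).1 h) hne) hsl hb' hE
  have hpm := UpPath.of_tight hS (ht.mono hmn hme) hum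
  obtain ⟨K₀, hK₀⟩ := exists_lastHigh (D := D) (S := S) (x := p)
    (by have := hF _ hp.free; unfold ten; omega) m
  have hfork : ∀ s : ℕ → V, D.UpPath S s k → s k = r k → D.LastHigh S s k K₀ := by
    intro s hs hsk
    refine fork hS hF hpm hs ht.alt hne hmn (by rw [hsk, ← hpN]; exact hp.adj n (by omega))
      (by rw [hsk, ← hpN]
          exact fun h => Nat.not_even_iff_odd.2 ((hp.mem_iff n (by omega)).1 h) hne)
      (fall_disjoint hS ht hp (hpN ▸ hb) (haw S (by omega)) hfall hs (hsk.trans hpN.symm)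
        (by omega)) (by omega) ?_ hK₀
    intro c hcm hck hce hpc hcb K₁ K₂ h₁ h₂
    have hck' : c < k := by
      refine lt_of_le_of_ne hck ?_
      rintro rfl
      have := hp.inj _ (by omega) _ le_rfl (hpc.trans (hsk.trans hpN.symm))
      omega
    exact ih c hck' p s K₁ K₂ (hpm.mono hcm hce) (hs.mono hck hce) hpc hcb h₁ h₂
  rw [hK.unique (hfork r hr rfl), hK'.unique (hfork r' hr' hrr.symm)]

end Levels

namespace Levels

variable {D : Levels M L}

/-! ### The base of a blossom is unique -/

/-- A base reached first by an odd path does not lie on rising paths shorter than its odd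
level. -/
theorem UpPath.ne_inner (hS : D.Stage (S + 1)) {r : ℕ → V} {k : ℕ} {b : V} (hr : D.UpPath S r k)
    (hb : 2 * S ≤ D.ten b) (hE : S < D.E b) (hO : k < D.O b) : ∀ j ≤ k, r j ≠ b := by
  rintro j hj rfl
  rcases hr.base_mem hS hj hb with ⟨-, h, h', -⟩ | ⟨-, h, -, h', -⟩ <;> omega

/-- The mate of a base reached first by an odd path does not lie on rising paths shorter than
this odd level. -/
theorem UpPath.ne_mate (hS : D.Stage (S + 1)) {r : ℕ → V} {k : ℕ} {b z : V} (hr : D.UpPath S r k)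
    (hbz : M.Adj b z) (hb : 2 * S ≤ D.ten b) (hE : S < D.E b) (hO : k < D.O b) :
    ∀ j ≤ k, r j ≠ z := by
  rintro j hj rfl
  rcases hr.alt.index_of_mate hS.matching hj hbz.symm with ⟨ho, h⟩ | ⟨-, -, h⟩
  · have hjk : j + 1 ≤ k := by
      have := Nat.odd_iff.1 ho; have := Nat.even_iff.1 hr.even; omega
    exact hr.ne_inner hS hb hE hO _ hjk (h hjk)
  · exact hr.ne_inner hS hb hE hO _ (by omega) h

/-- `b` is a base that is reached first by an odd path, namely by the path `r` of length `k`
followed by an unmatched edge. -/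
structure Lands (D : Levels M L) (S : ℕ) (r : ℕ → V) (k : ℕ) (b : V) : Prop where
  adj : G.Adj (r k) b
  not_mem : ¬ M.Adj (r k) b
  O_eq : D.O b = k + 1
  base : 2 * S ≤ D.ten b
  O_le : D.O b ≤ S

theorem Lands.lt_E (hS : D.Stage (S + 1)) {r : ℕ → V} {k : ℕ} {b : V} (h : D.Lands S r k b) :
    S < D.E b := by
  have hcap := hS.cap
  have h2 := D.E_even (v := b)
  have h3 := D.O_odd (v := b)
  have := h.base
  have := h.O_le
  unfold ten at *
  omega

theorem exists_lands (hS : D.Stage (S + 1)) {b : V} (hb : 2 * S ≤ D.ten b) (hO : D.O b ≤ S) :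
    ∃ r k, D.UpPath S r k ∧ D.Lands S r k b := by
  have hcap := hS.cap
  have h1 := D.E_even (v := b)
  obtain ⟨ho, x, hx, hxb⟩ := D.O_att b (by omega)
  have h2 := Nat.odd_iff.1 ho
  obtain ⟨k, hk⟩ : ∃ k, D.O b = k + 1 := ⟨D.O b - 1, by omega⟩
  rw [hk] at hx hxb ho
  have hke : Even k := by simp only [Nat.odd_iff, Nat.even_iff] at *; omega
  have hadj := hx.adj k (by omega)
  have hm : ¬ M.Adj (x k) (x (k + 1)) :=
    fun h => Nat.not_even_iff_odd.2 ((hx.mem_iff k (by omega)).1 h) hke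
  rw [hxb] at hadj hm
  have h3 := D.E_le x k (hx.mono (by omega)) hke
  have h4 := D.O_le_or_E_le hadj.symm (fun h => hm h.symm)
  refine ⟨x, k, .of_even hS (hx.mono (by omega)) hke ?_ (by omega), hadj, hm, hk, hb, hO⟩
  unfold ten at hb
  omega

/-- If both ends of a matched edge are bases of odd level `S`, then rising paths that land at them
have the same last vertex of high tenacity. -/
theorem lastHigh_of_matched (hS : D.Stage (S + 1)) (hF : ∀ f ∉ M.verts, 2 * S + 2 ≤ D.O f)
    {b z : V} (hbz : M.Adj b z) {r r' : ℕ → V} {k k' : ℕ} {K : V}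
    (hr : D.UpPath S r k) (hb : D.Lands S r k b) (hr' : D.UpPath S r' k')
    (hz : D.Lands S r' k' z) (hOb : D.O b = S) (hOz : D.O z = S) (hK : D.LastHigh S r k K) :
    D.LastHigh S r' k' K := by
  have hEb := hb.lt_E hS
  have hEz := hz.lt_E hS
  have := hb.O_eq
  have := hz.O_eq
  obtain ⟨g, hg, hgr, hg1, hg2⟩ := hr.alt.snoc_two hr.even hb.adj hb.not_mem hbz
    (hr.ne_inner hS hb.base hEb (by omega)) (hr.ne_inner hS hz.base hEz (by omega))
  have hup : D.UpPath S g k := by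
    refine .of_even hS (hg.mono (by omega)) hr.even ?_ (Or.inr (by omega))
    have h1 := D.E_le g k (hg.mono (by omega)) hr.even
    rw [hgr k le_rfl] at h1 ⊢
    have h2 := D.O_le_or_E_le hb.adj.symm (fun h => hb.not_mem h.symm)
    omega
  refine fork hS hF hup hr' hg (hr.even.add even_two) (by omega) (by rw [hg2]; exact hz.adj.symm)
    (by rw [hg2]; exact fun h => hz.not_mem h.symm) ?_ (by omega) ?_
    (lastHigh_congr (fun i hi => (hgr i hi).symm) hK)
  · intro i h1 h2 j hj hij
    rcases (show i = k + 1 ∨ i = k + 2 by omega) with rfl | rfl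
    · exact hr'.ne_inner hS hb.base hEb (by omega) j hj (hij.symm.trans hg1)
    · exact hr'.ne_inner hS hz.base hEz (by omega) j hj (hij.symm.trans hg2)
  · intro c hc hc' hce hgc hcb K₁ K₂ h₁ h₂
    exact anchor_unique hS hF c g r' K₁ K₂ (hup.mono hc hce) (hr'.mono hc' hce) hgc hcb h₁ h₂

theorem exists_mate_of_O_le (hF : ∀ f ∉ M.verts, 2 * S + 2 ≤ D.O f) (hM : M.IsMatching) {b : V}
    (hO : D.O b ≤ S) : ∃ z, M.Adj b z := by
  by_contra h
  have : b ∉ M.verts := fun hb => h (hM hb).exists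
  have := hF b this
  omega

theorem lands_unique (hS : D.Stage (S + 1)) (hF : ∀ f ∉ M.verts, 2 * S + 2 ≤ D.O f) {b : V}
    {r r' : ℕ → V} {k k' : ℕ} {K K' : V} (ht : D.ten b < 2 * S + 2) (hr : D.UpPath S r k)
    (hb : D.Lands S r k b) (hr' : D.UpPath S r' k') (hb' : D.Lands S r' k' b)
    (hK : D.LastHigh S r k K) (hK' : D.LastHigh S r' k' K') : K = K' := by
  have hcap := hS.cap
  obtain ⟨z, hbz⟩ := exists_mate_of_O_le hF hS.matching hb.O_le
  have hEz := D.E_mate hS.matching hbz.symm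
  have hEb := D.E_mate hS.matching hbz
  have hmate := ten_mate (D := D) hS.matching (s := S) (by omega) hbz
  have hmate' := ten_mate (D := D) hS.matching (s := S + 1) (by omega) hbz
  have hbase := hb.base
  have hO := hb.O_le
  have hE := hb.lt_E hS
  have hOk := hb.O_eq
  have hOk' := hb'.O_eq
  have hOz := D.O_cap z
  rcases hb.O_le.lt_or_eq with hlt | heq
  · -- Both paths extend to rising paths to the mate of `b`.
    have hext : ∀ s j J, D.UpPath S s j → D.Lands S s j b → D.LastHigh S s j J →
        ∃ g, D.UpPath S g (k + 2) ∧ g (k + 2) = z ∧ D.LastHigh S g (k + 2) J := by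
      intro s j J hs hsb hJ
      have hj := hsb.O_eq
      obtain rfl : j = k := by omega
      obtain ⟨g, hg, hgr, hg1, hg2⟩ := hs.alt.snoc_two hs.even hsb.adj hsb.not_mem hbz
        (hs.ne_inner hS hb.base hE (by omega)) (hs.ne_mate hS hbz hb.base hE (by omega))
      refine ⟨g, .of_even hS hg (hs.even.add even_two) (by rw [hg2]; omega) (Or.inr (by omega)),
        hg2, (lastHigh_iff (by omega) ?_).2 (lastHigh_congr (fun i hi => (hgr i hi).symm) hJ)⟩
      intro l h1 h2
      rcases (show l = j + 1 ∨ l = j + 2 by omega) with rfl | rfl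
      · rw [hg1]; exact ht
      · rw [hg2]; omega
    obtain ⟨g, hg, hgz, hgK⟩ := hext r k K hr hb hK
    obtain ⟨g', hg', hgz', hgK'⟩ := hext r' k' K' hr' hb' hK'
    exact anchor_unique hS hF _ g g' K K' hg hg' (hgz.trans hgz'.symm)
      (by rw [hgz]; omega) hgK hgK'
  · have hodd := ten_odd (D := D) (v := b) (by omega)
    have hz : D.O z = S := by unfold ten at *; omega
    obtain ⟨s, j, hs, hsz⟩ := exists_lands (D := D) hS (b := z) (by omega) hz.le
    exact (lastHigh_of_matched hS hF hbz hr hb hs hsz heq hz hK).unique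
      (lastHigh_of_matched hS hF hbz hr' hb' hs hsz heq hz hK')

/-- `K` is the anchor of `v`: the base of the blossom of `v` once all edges of tenacity at most
`2 * S + 1` are taken into account. It is found as the last vertex of high tenacity on a rising path
to `v`. -/
def Anchor (D : Levels M L) (S : ℕ) (v K : V) : Prop :=
  (2 * S + 2 ≤ D.ten v ∧ K = v) ∨ (D.ten v < 2 * S + 2 ∧
    ∃ r k, D.UpPath S r k ∧ D.LastHigh S r k K ∧ (r k = v ∨ D.Lands S r k v))

theorem UpPath.anchor {r : ℕ → V} {k : ℕ} {K : V} (hr : D.UpPath S r k)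
    (hK : D.LastHigh S r k K) : D.Anchor S (r k) K := by
  by_cases h : 2 * S + 2 ≤ D.ten (r k)
  · exact Or.inl ⟨h, hK.unique (lastHigh_self h)⟩
  · exact Or.inr ⟨by omega, r, k, hr, hK, Or.inl rfl⟩

theorem Anchor.of_base (hS : D.Stage (S + 1)) {v b K : V} (h : D.Anchor S v K)
    (hsim : D.Sim S v b) (hb : 2 * S ≤ D.ten b) : D.Anchor S b K := by
  have hcap := hS.cap
  have hG := hS.good S (by omega)
  by_cases hv : 2 * S ≤ D.ten v
  · rwa [← hG.unique _ _ hsim hv hb]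
  rcases h with ⟨h, -⟩ | ⟨-, r, k, hr, hK, rfl | hl⟩
  · omega
  · obtain ⟨i, hi, hib, hil⟩ := hr.block k le_rfl
    have heq : r i = b := hG.unique _ _ ((hil i le_rfl hi).trans hsim) hib hb
    have hlow : ∀ l, i < l → l ≤ k → D.ten (r l) < 2 * S := by
      intro l h1 h2
      by_contra hlb
      have := hr.alt.inj _ h2 _ hi (hG.unique _ _
        ((hil l h1.le h2).trans (hil i le_rfl hi).symm) (by omega) hib)
      omega
    have hie : Even i := by
      rcases hr.base_mem hS hi hib with h | ⟨-, h1, -, -, -, hm⟩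
      · exact h.1
      · have := ten_mate (D := D) hS.matching (s := S) (by omega) hm
        have := hlow (i + 1) (by omega) h1
        omega
    rw [← heq]
    exact (hr.mono hi hie).anchor
      ((lastHigh_iff hi fun l h1 h2 => by have := hlow l h1 h2; omega).1 hK)
  · exact absurd hl.base hv

theorem Anchor.unique (hS : D.Stage (S + 1)) (hF : ∀ f ∉ M.verts, 2 * S + 2 ≤ D.O f)
    {v w K K' : V} (hsim : D.Sim S v w) (h : D.Anchor S v K) (h' : D.Anchor S w K') :
    K = K' := by
  obtain ⟨b, hvb, hb⟩ := (hS.good S (by omega)).exists_base v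
  replace h := h.of_base hS hvb hb
  replace h' := h'.of_base hS (hsim.symm.trans hvb) hb
  rcases h with ⟨h1, rfl⟩ | ⟨h1, r, k, hr, hK, hrb⟩
  · rcases h' with ⟨-, rfl⟩ | ⟨h2, -⟩
    · rfl
    · omega
  rcases h' with ⟨h2, -⟩ | ⟨-, r', k', hr', hK', hrb'⟩
  · omega
  have hmix : ∀ s j s' j', D.UpPath S s j → s j = b → D.Lands S s' j' b → False := by
    intro s j s' j' hs hsb hl
    have := hs.level j le_rfl hs.even (by rw [hsb]; exact hb)
    have := hl.lt_E hS
    rw [hsb] at *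
    omega
  rcases hrb with rfl | hrb
  · rcases hrb' with hrb' | hrb'
    · have h1 := hr.level k le_rfl hr.even hb
      have h2 := hr'.level k' le_rfl hr'.even (by rw [hrb']; exact hb)
      rw [hrb'] at h2
      obtain rfl : k = k' := by omega
      exact anchor_unique hS hF k r r' K K' hr hr' hrb'.symm hb hK hK'
    · exact (hmix r k r' k' hr rfl hrb').elim
  · rcases hrb' with hrb' | hrb'
    · exact (hmix r' k' r k hr' hrb' hrb).elim
    · exact lands_unique hS hF h1 hr hrb hr' hrb' hK hK'

theorem exists_anchor (hS : D.Stage (S + 1)) (hF : ∀ f ∉ M.verts, 2 * S + 2 ≤ D.O f) (v : V) :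
    ∃ K, D.Anchor S v K := by
  by_cases hh : 2 * S + 2 ≤ D.ten v
  · exact ⟨v, Or.inl ⟨hh, rfl⟩⟩
  have hlast : ∀ r k, D.UpPath S r k → ∃ K, D.LastHigh S r k K := fun r k hr =>
    exists_lastHigh (by have := hF _ hr.alt.free; unfold ten; omega) k
  by_cases hv : D.ten v < 2 * S ∨ D.E v ≤ S
  · obtain ⟨r, hr, hrv⟩ := exists_upPath hS hv
    obtain ⟨K, hK⟩ := hlast r _ hr
    exact ⟨K, Or.inr ⟨by omega, r, _, hr, hK, Or.inl hrv⟩⟩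
  · obtain ⟨r, k, hr, hl⟩ := exists_lands (D := D) hS (b := v) (by omega)
      (by unfold ten at *; omega)
    obtain ⟨K, hK⟩ := hlast r k hr
    exact ⟨K, Or.inr ⟨by omega, r, k, hr, hK, Or.inr hl⟩⟩

/-- The ends of a matched edge have the same anchor if one of them is a base reached first by an
even path. -/
theorem anchor_matched (hS : D.Stage (S + 1)) (hF : ∀ f ∉ M.verts, 2 * S + 2 ≤ D.O f)
    {u v K K' : V} (hm : M.Adj u v) (hb : 2 * S ≤ D.ten u) (ht : D.ten u < 2 * S + 2)
    (hE : D.E u ≤ S) (h : D.Anchor S u K) (h' : D.Anchor S v K') : K = K' := by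
  have hcap := hS.cap
  obtain ⟨r, hr, hru⟩ := exists_upPath hS (Or.inr hE)
  obtain ⟨K₀, hK₀⟩ := exists_lastHigh (D := D) (S := S) (x := r)
    (by have := hF _ hr.alt.free; unfold ten; omega) (D.E u)
  have hEm := D.E_mate hS.matching hm
  have hmate := ten_mate (D := D) hS.matching (s := S) (by omega) hm
  have hmate' := ten_mate (D := D) hS.matching (s := S + 1) (by omega) hm
  have hEe := Nat.even_iff.1 hr.even
  obtain ⟨k, hk⟩ : ∃ k, D.E u = k + 2 := ⟨D.E u - 2, by omega⟩
  rw [hk] at hr hru hK₀ hEe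
  have hke : Even k := by rw [Nat.even_iff]; omega
  have hrv : r (k + 1) = v := by
    rcases hr.alt.index_of_mate hS.matching le_rfl (w := v) (by rwa [hru]) with ⟨ho, -⟩ | ⟨-, -, h⟩
    · have := Nat.odd_iff.1 ho; omega
    · exact h
  have hK : D.LastHigh S r k K₀ := (lastHigh_iff (by omega) (by
    intro l h1 h2
    rcases (show l = k + 1 ∨ l = k + 2 by omega) with rfl | rfl
    · rw [hrv]; omega
    · rw [hru]; omega)).1 hK₀
  have hu := hr.anchor hK₀
  rw [hru] at hu
  have hv : D.Anchor S v K₀ := Or.inr ⟨by omega, r, k, hr.mono (by omega) hke, hK, Or.inr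
    ⟨hrv ▸ hr.alt.adj k (by omega), hrv ▸ fun h =>
      Nat.not_even_iff_odd.2 ((hr.alt.mem_iff k (by omega)).1 h) hke, by omega, by omega, by omega⟩⟩
  exact (h.unique hS hF (Sim.refl u) hu).trans (hv.unique hS hF (Sim.refl v) h')

/-- The ends of an unmatched edge of tenacity `2 * S + 1` have the same anchor. -/
theorem anchor_unmatched (hS : D.Stage (S + 1)) (hF : ∀ f ∉ M.verts, 2 * S + 2 ≤ D.O f)
    {u v K K' : V} (hadj : G.Adj u v) (hm : ¬ M.Adj u v) (hsum : D.E u + D.E v = 2 * S)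
    (hE : D.E u ≤ S) (h : D.Anchor S u K) (h' : D.Anchor S v K') : K = K' := by
  have hcap := hS.cap
  have hhigh : ∀ x : ℕ → V, x 0 ∉ M.verts → 2 * S + 2 ≤ D.ten (x 0) := fun x hx => by
    have := hF _ hx; unfold ten; omega
  obtain ⟨r, hr, hru⟩ := exists_upPath hS (Or.inr hE)
  obtain ⟨K₀, hK₀⟩ := exists_lastHigh (D := D) (hhigh r hr.alt.free) (D.E u)
  have hu := hr.anchor hK₀
  rw [hru] at hu
  rw [h.unique hS hF (Sim.refl u) hu]
  by_cases hv : D.ten v < 2 * S ∨ D.E v ≤ S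
  · obtain ⟨r', hr', hrv'⟩ := exists_upPath hS hv
    have hK' : D.LastHigh S r' (D.E v) K₀ := fork hS hF hr hr' hr.alt hr.even le_rfl
      (by rwa [hru, hrv']) (by rwa [hru, hrv']) (fun i h1 h2 => by omega) hsum
      (fun c hc hc' hce hrc hcb K₁ K₂ h₁ h₂ => anchor_unique hS hF c r r' K₁ K₂
        (hr.mono hc hce) (hr'.mono hc' hce) hrc hcb h₁ h₂) hK₀
    have hv' := hr'.anchor hK'
    rw [hrv'] at hv'
    exact hv'.unique hS hF (Sim.refl v) h'
  · have h1 := D.O_le_or_E_le hadj.symm (fun h => hm h.symm)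
    have h2 := D.O_odd (v := v)
    have h3 := D.E_even (v := v)
    have hv' : D.Anchor S v K₀ := by
      refine Or.inr ⟨by unfold ten at *; omega, r, D.E u, hr, hK₀, Or.inr
        ⟨by rwa [hru], by rwa [hru], ?_, by omega, by omega⟩⟩
      unfold ten at hv
      omega
    exact hv'.unique hS hF (Sim.refl v) h'

theorem Anchor.eq_of_adj (hS : D.Stage (S + 1)) (hF : ∀ f ∉ M.verts, 2 * S + 2 ≤ D.O f)
    {u v K K' : V} (hadj : (D.lowGraph (S + 1)).Adj u v) (h : D.Anchor S u K)
    (h' : D.Anchor S v K') : K = K' := by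
  have hcap := hS.cap
  by_cases hsim : D.Sim S u v
  · exact h.unique hS hF hsim h'
  obtain ⟨hG, ⟨hm, hlt⟩ | ⟨hm, hlt⟩⟩ := hadj
  · have hmate := ten_mate (D := D) hS.matching (s := S) (by omega) hm
    have hmate' := ten_mate (D := D) hS.matching (s := S + 1) (by omega) hm
    have hEu := D.E_mate hS.matching hm
    have hEv := D.E_mate hS.matching hm.symm
    have hbu : 2 * S ≤ D.ten u := by
      by_contra hc
      exact hsim (sim_of_matched hS.matching (by omega) hm (by omega))
    have htu : D.ten u < 2 * S + 2 := by unfold ten; omega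
    rcases Nat.lt_or_ge S (D.E u) with hu | hu
    · rcases Nat.lt_or_ge S (D.E v) with hv | hv
      · have hOu : D.O u = S := by omega
        have hOv : D.O v = S := by omega
        have hl : ∀ w J, D.Anchor S w J → D.ten w < 2 * S + 2 → 2 * S ≤ D.ten w → S < D.E w →
            ∃ r k, D.UpPath S r k ∧ D.LastHigh S r k J ∧ D.Lands S r k w := by
          rintro w J (⟨h1, -⟩ | ⟨-, r, k, hr, hK, rfl | hl⟩) ht hb hE
          · omega
          · have := hr.level k le_rfl hr.even hb; omega
          · exact ⟨r, k, hr, hK, hl⟩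
        obtain ⟨r, k, hr, hK, hrl⟩ := hl u K h htu hbu hu
        obtain ⟨r', k', hr', hK', hrl'⟩ := hl v K' h' (by omega) (by omega) hv
        exact (lastHigh_of_matched hS hF hm hr hrl hr' hrl' hOu hOv hK).unique hK'
      · exact (anchor_matched hS hF hm.symm (by omega) (by omega) hv h' h).symm
    · exact anchor_matched hS hF hm hbu htu hu h h'
  · have h1 : 2 * S ≤ D.E u + D.E v + 1 := by
      by_contra hc
      exact hsim (sim_of_unmatched hG hm (by omega))
    have h2 := D.E_even (v := u)
    have h3 := D.E_even (v := v)
    rcases Nat.lt_or_ge S (D.E u) with hu | hu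
    · exact (anchor_unmatched hS hF hG.symm (fun h => hm h.symm) (by omega) (by omega) h' h).symm
    · exact anchor_unmatched hS hF hG hm (by omega) hu h h'

theorem LastHigh.sim (hS : D.Stage (S + 1)) {r : ℕ → V} {k : ℕ} {K : V} (hr : D.UpPath S r k)
    (hK : D.LastHigh S r k K) : D.Sim (S + 1) K (r k) := by
  have hcap := hS.cap
  obtain ⟨i, hi, rfl, hh, hl⟩ := hK
  obtain ⟨d, rfl⟩ := Nat.exists_eq_add_of_le hi
  have : ∀ e ≤ d, D.Sim (S + 1) (r i) (r (i + e)) := by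
    intro e
    induction e with
    | zero => exact fun _ => Sim.refl _
    | succ e ih =>
      intro he
      refine (ih (by omega)).trans ?_
      have hlow := hl (i + (e + 1)) (by omega) (by omega)
      rw [← add_assoc] at hlow ⊢
      have hadj := hr.alt.adj (i + e) (by omega)
      have hmem := hr.alt.mem_iff (i + e) (by omega)
      rcases Nat.even_or_odd (i + e) with hev | hod
      · by_cases hsim : D.Sim S (r (i + e)) (r (i + e + 1))
        · exact hsim.mono (Nat.le_succ S)
        · have h1 := hr.rise (i + e) (by omega) hev hsim
          rw [kap_of_ten_le (by omega)] at h1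
          exact sim_of_unmatched hadj (fun h => Nat.not_even_iff_odd.2 (hmem.1 h) hev) (by omega)
      · exact (sim_of_matched hS.matching (by omega) (hmem.2 hod).symm (by omega)).symm
  exact this d le_rfl

theorem Anchor.sim (hS : D.Stage (S + 1)) {v K : V} (h : D.Anchor S v K) :
    D.Sim (S + 1) v K ∧ 2 * (S + 1) ≤ D.ten K := by
  rcases h with ⟨h, rfl⟩ | ⟨ht, r, k, hr, hK, hv⟩
  · exact ⟨Sim.refl _, by omega⟩
  · refine ⟨Sim.symm ?_, by obtain ⟨i, -, -, hh, -⟩ := hK; omega⟩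
    rcases hv with rfl | hl
    · exact hK.sim hS hr
    · refine (hK.sim hS hr).trans (sim_of_unmatched hl.adj hl.not_mem ?_)
      have := D.E_le r k hr.alt hr.even
      have := hl.O_eq
      unfold ten at ht
      omega

/-- If no augmenting path has length `2 * S + 1`, then also the blossoms formed by the edges of
tenacity `2 * S + 1` have unique bases. -/
theorem goodBase_succ (hS : D.Stage (S + 1)) (hF : ∀ f ∉ M.verts, 2 * S + 2 ≤ D.O f) :
    D.GoodBase (S + 1) where
  exists_base v := by
    obtain ⟨K, hK⟩ := exists_anchor hS hF v
    exact ⟨K, hK.sim hS⟩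
  unique b b' hsim hb hb' := by
    have h : ∀ u w, (D.lowGraph (S + 1)).Walk u w → ∀ K K', D.Anchor S u K → D.Anchor S w K' →
        K = K' := by
      intro u w p
      induction p with
      | nil => exact fun K K' h h' => h.unique hS hF (Sim.refl _) h'
      | @cons u v w hadj p ih =>
        intro K K' h h'
        obtain ⟨K₀, hK₀⟩ := exists_anchor hS hF v
        exact (h.eq_of_adj hS hF hadj hK₀).trans (ih K₀ K' hK₀ h')
    obtain ⟨p⟩ := hsim
    exact h b b' p b b' (Or.inl ⟨by omega, rfl⟩) (Or.inl ⟨by omega, rfl⟩)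

theorem goodBase_zero : D.GoodBase 0 where
  exists_base v := ⟨v, Sim.refl v, by omega⟩
  unique b b' h _ _ := by
    obtain ⟨p⟩ := h
    cases p with
    | nil => rfl
    | cons hadj _ => obtain ⟨_, ⟨_, h⟩ | ⟨_, h⟩⟩ := hadj <;> omega

theorem stage_of_free (hM : M.IsMatching) {T : ℕ} (hpos : 0 < T) (hcap : 2 * T < L)
    (hF : ∀ f ∉ M.verts, 2 * T ≤ D.O f + 1) : D.Stage T := by
  refine ⟨hM, hpos, hcap, hF, fun s => ?_⟩
  induction s using Nat.strong_induction_on with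
  | _ s ih =>
  intro hs
  cases s with
  | zero => exact goodBase_zero
  | succ s =>
    exact goodBase_succ ⟨hM, Nat.succ_pos s, by omega, fun f hf => by have := hF f hf; omega,
      fun s' hs' => ih s' hs' (by omega)⟩ fun f hf => by have := hF f hf; omega

end Levels

/-! ### Walks and vertex sequences -/

theorem exists_walk (n : ℕ) : ∀ x : ℕ → V, (∀ i < n, G.Adj (x i) (x (i + 1))) →
    ∃ p : G.Walk (x 0) (x n), p.length = n ∧ ∀ i ≤ n, p.getVert i = x i := by
  induction n with
  | zero => exact fun x _ => ⟨.nil, rfl, fun i hi => by rw [Nat.le_zero.1 hi]; rfl⟩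
  | succ n ih =>
    intro x hx
    obtain ⟨p, hp, hv⟩ := ih (fun i => x (i + 1)) fun i hi => hx (i + 1) (by omega)
    refine ⟨.cons (hx 0 (by omega)) p, by simp [hp], fun i hi => ?_⟩
    cases i with
    | zero => rfl
    | succ i => simpa using hv i (by omega)

theorem Alt.exists_isAlternatingPathTo {x : ℕ → V} {n : ℕ} (h : Alt M x n) :
    ∃ p : G.Walk (x 0) (x n), p.length = n ∧ (∀ i ≤ n, p.getVert i = x i) ∧
      IsAlternatingPathTo M p := by
  obtain ⟨p, hp, hv⟩ := exists_walk n x h.adj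
  refine ⟨p, hp, hv, h.free, ?_, ?_⟩
  · rw [← SimpleGraph.Walk.IsPath.getVert_injOn_iff]
    intro i hi j hj hij
    simp only [Set.mem_ofPred_eq, hp] at hi hj
    rw [hv i hi, hv j hj] at hij
    exact h.inj i hi j hj hij
  · rw [List.isChain_iff_getElem]
    intro i hi
    rw [SimpleGraph.Walk.length_edges, hp] at hi
    rw [SimpleGraph.Walk.getElem_edges, SimpleGraph.Walk.getElem_edges, hv i (by omega),
      hv (i + 1) (by omega), hv (i + 1 + 1) (by omega), SimpleGraph.Subgraph.mem_edgeSet,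
      SimpleGraph.Subgraph.mem_edgeSet, h.mem_iff i (by omega), h.mem_iff (i + 1) (by omega),
      Nat.odd_add_one, not_not]

theorem IsAlternatingPathTo.alt {f v : V} {p : G.Walk f v} (h : IsAlternatingPathTo M p) :
    Alt M p.getVert p.length := by
  obtain ⟨hf, hp, hc⟩ := h
  refine ⟨by rw [SimpleGraph.Walk.getVert_zero]; exact hf,
    fun i hi => p.adj_getVert_succ hi, fun i => ?_,
    fun i hi j hj hij =>
    (SimpleGraph.Walk.IsPath.getVert_injOn hp) hi hj hij⟩
  induction i with
  | zero =>
    intro _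
    simp only [SimpleGraph.Walk.getVert_zero, Nat.not_odd_zero, iff_false]
    exact fun h => hf (M.edge_vert h)
  | succ i ih =>
    intro hi
    rw [List.isChain_iff_getElem] at hc
    have := hc i (by rw [SimpleGraph.Walk.length_edges]; omega)
    rw [SimpleGraph.Walk.getElem_edges, SimpleGraph.Walk.getElem_edges,
      SimpleGraph.Subgraph.mem_edgeSet, SimpleGraph.Subgraph.mem_edgeSet, ih (by omega)] at this
    rw [Nat.odd_add_one, this, not_not]

theorem evenLevel_le {x : ℕ → V} {n : ℕ} (h : Alt M x n) (hn : Even n) :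
    evenLevel M (x n) ≤ n := by
  obtain ⟨p, hp, -, hp'⟩ := h.exists_isAlternatingPathTo
  have : evenLevel M (x n) ≤ p.length := iInf_le_of_le _ (iInf_le_of_le p
    (iInf_le_of_le ⟨hp', by rw [hp]; exact hn⟩ le_rfl))
  rwa [hp] at this

theorem oddLevel_le {x : ℕ → V} {n : ℕ} (h : Alt M x n) (hn : Odd n) :
    oddLevel M (x n) ≤ n := by
  obtain ⟨p, hp, -, hp'⟩ := h.exists_isAlternatingPathTo
  have : oddLevel M (x n) ≤ p.length := iInf_le_of_le _ (iInf_le_of_le p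
    (iInf_le_of_le ⟨hp', by rw [hp]; exact hn⟩ le_rfl))
  rwa [hp] at this

theorem exists_of_evenLevel_eq {v : V} {n : ℕ} (h : evenLevel M v = n) :
    Even n ∧ ∃ x, Alt M x n ∧ x n = v := by
  have hlt : evenLevel M v < (n + 1 : ℕ) := by rw [h]; exact_mod_cast Nat.lt_succ_self n
  unfold evenLevel at hlt
  simp only [iInf_lt_iff] at hlt
  obtain ⟨f, p, ⟨hp, he⟩, hlen⟩ := hlt
  have h1 := evenLevel_le hp.alt he
  rw [SimpleGraph.Walk.getVert_length, h] at h1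
  have h2 : p.length = n := le_antisymm (Nat.lt_succ_iff.1 (by exact_mod_cast hlen))
    (by exact_mod_cast h1)
  subst h2
  exact ⟨he, _, hp.alt, p.getVert_length⟩

theorem exists_of_oddLevel_eq {v : V} {n : ℕ} (h : oddLevel M v = n) :
    Odd n ∧ ∃ x, Alt M x n ∧ x n = v := by
  have hlt : oddLevel M v < (n + 1 : ℕ) := by rw [h]; exact_mod_cast Nat.lt_succ_self n
  unfold oddLevel at hlt
  simp only [iInf_lt_iff] at hlt
  obtain ⟨f, p, ⟨hp, he⟩, hlen⟩ := hlt
  have h1 := oddLevel_le hp.alt he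
  rw [SimpleGraph.Walk.getVert_length, h] at h1
  have h2 : p.length = n := le_antisymm (Nat.lt_succ_iff.1 (by exact_mod_cast hlen))
    (by exact_mod_cast h1)
  subst h2
  exact ⟨he, _, hp.alt, p.getVert_length⟩

/-- The extended natural number `a` truncated at `L`. -/
noncomputable def trunc (L : ℕ) (a : ℕ∞) : ℕ := (min a L).toNat

theorem trunc_coe (L n : ℕ) : trunc L (n : ℕ∞) = min n L := by
  rcases le_total n L with h | h <;> simp [trunc, h]

theorem trunc_top (L : ℕ) : trunc L ⊤ = L := by simp [trunc]

theorem trunc_mono (L : ℕ) {a b : ℕ∞} (h : a ≤ b) : trunc L a ≤ trunc L b :=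
  ENat.toNat_le_toNat (min_le_min_right _ h)
    (ne_top_of_le_ne_top (ENat.natCast_ne_top L) (min_le_right _ _))

theorem eq_trunc {L : ℕ} {a : ℕ∞} (h : trunc L a < L) : a = trunc L a := by
  induction a using ENat.recTopCoe with
  | top => rw [trunc_top] at h; omega
  | coe n => rw [trunc_coe] at *; congr 1; omega

theorem add_eq_iff_trunc {L n : ℕ} (hn : n < L) (a b : ℕ∞) :
    a + b = n ↔ trunc L a + trunc L b = n := by
  induction a using ENat.recTopCoe with
  | top =>
    rw [trunc_top, top_add]; exact ⟨fun h => absurd h (ENat.top_ne_natCast n), fun h => by omega⟩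
  | coe a =>
    induction b using ENat.recTopCoe with
    | top =>
      rw [trunc_top, add_top]; exact ⟨fun h => absurd h (ENat.top_ne_natCast n), fun h => by omega⟩
    | coe b => rw [trunc_coe, trunc_coe, ← Nat.cast_add, Nat.cast_inj]; omega

/-- The truncated levels of the vertices. -/
noncomputable def levels (M : G.Subgraph) (L : ℕ) : Levels M L where
  E v := trunc L (evenLevel M v)
  O v := trunc L (oddLevel M v)
  E_cap v := by
    rw [← trunc_top L]; exact trunc_mono L le_top |>.trans (by rw [trunc_top])
  O_cap v := by
    rw [← trunc_top L]; exact trunc_mono L le_top |>.trans (by rw [trunc_top])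
  E_le x n h hn := (trunc_mono L (evenLevel_le h hn)).trans (by rw [trunc_coe]; omega)
  O_le x n h hn := (trunc_mono L (oddLevel_le h hn)).trans (by rw [trunc_coe]; omega)
  E_att v hv := exists_of_evenLevel_eq (eq_trunc hv)
  O_att v hv := exists_of_oddLevel_eq (eq_trunc hv)

/-! ### Props and bridges in terms of levels -/

theorem isPropEdge_of_alt {x : ℕ → V} {n : ℕ} (h : Alt M x (n + 1))
    (hmin : (Even (n + 1) ∧ evenLevel M (x (n + 1)) = (n + 1 : ℕ) ∧
      evenLevel M (x (n + 1)) ≤ oddLevel M (x (n + 1))) ∨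
      (Odd (n + 1) ∧ oddLevel M (x (n + 1)) = (n + 1 : ℕ) ∧
      oddLevel M (x (n + 1)) ≤ evenLevel M (x (n + 1)))) : IsPropEdge M s(x n, x (n + 1)) := by
  obtain ⟨p, hp, hv, hp'⟩ := h.exists_isAlternatingPathTo
  refine ⟨x n, x (n + 1), ⟨x 0, p, ?_, ?_, ?_⟩, rfl⟩
  · rcases hmin with ⟨h1, h2, h3⟩ | ⟨h1, h2, h3⟩
    · exact ⟨Or.inl ⟨hp', by rw [hp]; exact h1, by rw [hp, h2]⟩,
        by rw [hp, minLevel, min_eq_left h3, h2]⟩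
    · exact ⟨Or.inr ⟨hp', by rw [hp]; exact h1, by rw [hp, h2]⟩,
        by rw [hp, minLevel, min_eq_right h3, h2]⟩
  · rw [← SimpleGraph.Walk.length_eq_zero_iff, hp]; omega
  · rw [SimpleGraph.Walk.penultimate, hp]; exact hv n (by omega)

theorem le_of_trunc_le {a b : ℕ∞} (h : trunc L a ≤ trunc L b) (hL : trunc L a < L) : a ≤ b := by
  rw [eq_trunc hL]
  induction b using ENat.recTopCoe with
  | top => exact le_top
  | coe b => rw [trunc_coe L b] at h; exact_mod_cast h.trans (min_le_left _ _)

theorem isPropEdge_of_matched (hM : M.IsMatching) {w z : V} (h : M.Adj w z)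
    (hE : (levels M L).E w < L) (hEO : (levels M L).E w ≤ (levels M L).O w) :
    IsPropEdge M s(w, z) := by
  obtain ⟨he, x, hx, hxw⟩ := (levels M L).E_att w hE
  rcases hx.index_of_mate hM le_rfl (w := z) (by rwa [hxw]) with ⟨ho, -⟩ | ⟨-, h0, h1⟩
  · exact absurd he (Nat.not_even_iff_odd.2 ho)
  · obtain ⟨n, hn⟩ : ∃ n, (levels M L).E w = n + 1 := ⟨(levels M L).E w - 1, by omega⟩
    rw [hn] at hx hxw he h1
    have := isPropEdge_of_alt hx (Or.inl ⟨he, by rw [hxw, ← hn]; exact eq_trunc hE,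
      by rw [hxw]; exact le_of_trunc_le hEO hE⟩)
    rw [hxw, show x n = z from h1, Sym2.eq_swap] at this
    exact this

theorem isPropEdge_of_unmatched {u w : V} (h : G.Adj u w) (hm : ¬ M.Adj u w)
    (hO : (levels M L).O w < L) (hOE : (levels M L).O w = (levels M L).E u + 1)
    (hle : (levels M L).O w < (levels M L).E w) : IsPropEdge M s(u, w) := by
  obtain ⟨he, x, hx, hxu⟩ := (levels M L).E_att u (by omega)
  have hx' := hx.snoc (w := w) (by rwa [hxu])
    (by rw [hxu]; exact ⟨fun h => absurd h hm, fun h => absurd he (Nat.not_even_iff_odd.2 h)⟩) (by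
      rintro i hi rfl
      rcases Nat.even_or_odd i with h' | h'
      · have := (levels M L).E_le x i (hx.mono hi) h'; omega
      · have := (levels M L).O_le x i (hx.mono hi) h'; omega)
  have := isPropEdge_of_alt hx' (Or.inr ⟨he.add_one,
    by rw [joinAt_succ, ← hOE]; exact eq_trunc hO,
    by rw [joinAt_succ]; exact le_of_trunc_le hle.le hO⟩)
  rwa [joinAt_succ, joinAt_of_le le_rfl, hxu] at this

theorem IsPredecessor.cases (L : ℕ) {u v : V} (h : IsPredecessor M u v) :
    (M.Adj u v ∧ (levels M L).E v ≤ (levels M L).O v) ∨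
    (¬ M.Adj u v ∧ min ((levels M L).E u + 1) L ≤ (levels M L).O v ∧
      (levels M L).O v ≤ (levels M L).E v) := by
  obtain ⟨f, p, ⟨hp, hmin⟩, hnil, rfl⟩ := h
  rw [← SimpleGraph.Walk.length_eq_zero_iff] at hnil
  obtain ⟨n, hn⟩ : ∃ n, p.length = n + 1 := ⟨p.length - 1, by omega⟩
  have hpen : p.penultimate = p.getVert n := by rw [SimpleGraph.Walk.penultimate, hn]; rfl
  have hend : p.getVert (n + 1) = v := by rw [← hn]; exact p.getVert_length
  rw [hpen]
  rcases hp with ⟨hp, he, hl⟩ | ⟨hp, ho, hl⟩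
  · have halt := hp.alt
    rw [hn] at halt he
    have hm := (halt.mem_iff n (by omega)).2 (by
      simp only [Nat.odd_iff, Nat.even_iff] at *; omega)
    rw [hend] at hm
    exact Or.inl ⟨hm, trunc_mono L (by rw [← hl, hmin]; exact min_le_right _ _)⟩
  · have halt := hp.alt
    rw [hn] at halt ho
    have hne : Even n := by simp only [Nat.odd_iff, Nat.even_iff] at *; omega
    have hm : ¬ M.Adj (p.getVert n) v := fun h =>
      Nat.not_even_iff_odd.2 ((halt.mem_iff n (by omega)).1 (by rwa [hend])) hne
    refine Or.inr ⟨hm, ?_, trunc_mono L (by rw [← hl, hmin]; exact min_le_left _ _)⟩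
    have h1 := (levels M L).E_le _ n (halt.mono (by omega)) hne
    have h2 : (levels M L).O v = min (n + 1) L := by
      change trunc L (oddLevel M v) = _
      rw [← hl, hn, trunc_coe]
    omega

theorem edgeTenacity_matched {S : ℕ} (hL : 2 * S + 1 < L) {u v : V} (h : M.Adj u v) :
    edgeTenacity M s(u, v) = (2 * S + 1 : ℕ) ↔ (levels M L).O u + (levels M L).O v = 2 * S := by
  rw [edgeTenacity, Sym2.lift_mk]
  simp only [if_pos h]
  exact Iff.trans ⟨fun h => ENat.add_left_injective_of_ne_top ENat.one_ne_top h, fun h => by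
    rw [h]; rfl⟩ (add_eq_iff_trunc (by omega) _ _)

theorem edgeTenacity_unmatched {S : ℕ} (hL : 2 * S + 1 < L) {u v : V} (h : ¬ M.Adj u v) :
    edgeTenacity M s(u, v) = (2 * S + 1 : ℕ) ↔ (levels M L).E u + (levels M L).E v = 2 * S := by
  rw [edgeTenacity, Sym2.lift_mk]
  simp only [if_neg h]
  exact Iff.trans ⟨fun h => ENat.add_left_injective_of_ne_top ENat.one_ne_top h, fun h => by
    rw [h]; rfl⟩ (add_eq_iff_trunc (by omega) _ _)

/-! ### Bridges of given tenacity on tight paths -/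

/-- The edge `e` is a bridge of tenacity `2 * S + 1`. -/
def BridgeOf (M : G.Subgraph) (S : ℕ) (e : Sym2 V) : Prop :=
  IsBridgeEdge M e ∧ edgeTenacity M e = (2 * S + 1 : ℕ)

theorem not_bridgeOf_matched_low (hS : (levels M L).Stage (S + 1)) {w z : V} (h : M.Adj w z)
    (hw : (levels M L).ten w < 2 * S) : ¬ BridgeOf M S s(w, z) := by
  rintro ⟨-, ht⟩
  have := hS.cap
  rw [edgeTenacity_matched (L := L) (by omega) h] at ht
  have := (levels M L).E_mate hS.matching h
  unfold Levels.ten at hw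
  omega

theorem not_bridgeOf_matched (hS : (levels M L).Stage (S + 1)) {w z : V} (h : M.Adj w z)
    (hw : 2 * S ≤ (levels M L).ten w) (hE : (levels M L).E w ≤ S) :
    ¬ BridgeOf M S s(w, z) := by
  rintro ⟨⟨-, hp⟩, -⟩
  have := hS.cap
  unfold Levels.ten at hw
  exact hp (isPropEdge_of_matched (L := L) hS.matching h (by omega) (by omega))

theorem not_bridgeOf_unmatched (hS : (levels M L).Stage (S + 1)) {u w : V} (h : G.Adj u w)
    (hm : ¬ M.Adj u w) (hO : (levels M L).O w ≤ S)
    (hOE : (levels M L).O w = (levels M L).E u + 1)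
    (hlt : (levels M L).O w < (levels M L).E w) : ¬ BridgeOf M S s(u, w) := by
  rintro ⟨⟨-, hp⟩, -⟩
  have := hS.cap
  exact hp (isPropEdge_of_unmatched h hm (by omega) hOE hlt)

theorem Levels.slack_comm (D : Levels M L) (T : ℕ) (u v : V) :
    D.slack T u v = D.slack T v u := by
  unfold slack
  have : ∀ s, ind (D.Sim s u v) = ind (D.Sim s v u) := fun s =>
    congrArg ind (propext ⟨Sim.symm, Sim.symm⟩)
  simp only [this]
  ring

/-- A tight edge inside a blossom of smaller tenacity has smaller tenacity. -/
theorem not_bridgeOf_sim (hS : (levels M L).Stage (S + 1)) {u v : V} (h : G.Adj u v)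
    (hm : ¬ M.Adj u v) (hs : (levels M L).slack (S + 1) u v = 0)
    (hsim : (levels M L).Sim S u v) : ¬ BridgeOf M S s(u, v) := by
  rintro ⟨-, ht⟩
  have hcap := hS.cap
  rw [edgeTenacity_unmatched (L := L) (by omega) hm] at ht
  have hk : ∀ a b, (levels M L).Sim S a b → a ≠ b →
      (levels M L).kap (S + 1) a = (levels M L).E a := by
    intro a b hab hne
    rcases Nat.lt_or_ge ((levels M L).ten a) (2 * S) with h | h
    · exact Levels.kap_of_ten_le (by omega)
    · have := (Levels.base_outer hS.matching (by omega) hab hne h).1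
      exact Levels.kap_of_E_le (by omega)
  have := Levels.slack_of_sim hsim
  rw [hk u v hsim h.ne, hk v u hsim.symm h.ne'] at this
  omega

/-- A tight unmatched edge between two different blossoms that are both reached first by even paths
is a bridge. -/
theorem bridgeOf_unmatched (hS : (levels M L).Stage (S + 1)) {u v : V} (h : G.Adj u v)
    (hm : ¬ M.Adj u v) (hs : (levels M L).slack (S + 1) u v = 0)
    (hsim : ¬ (levels M L).Sim S u v)
    (hu : (levels M L).ten u < 2 * S ∨ (levels M L).E u ≤ S)
    (hv : (levels M L).ten v < 2 * S ∨ (levels M L).E v ≤ S) : BridgeOf M S s(u, v) := by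
  have hcap := hS.cap
  have hk : ∀ a, ((levels M L).ten a < 2 * S ∨ (levels M L).E a ≤ S) →
      (levels M L).kap (S + 1) a = (levels M L).E a := by
    rintro a (h | h)
    · exact Levels.kap_of_ten_le (by omega)
    · exact Levels.kap_of_E_le (by omega)
  have hsum : (levels M L).E u + (levels M L).E v = 2 * S := by
    rw [Levels.slack_of_not_sim hsim, hk u hu, hk v hv] at hs
    omega
  have hpred : ∀ a b, (levels M L).E a + (levels M L).E b = 2 * S → ¬ M.Adj a b →
      ((levels M L).ten b < 2 * S ∨ (levels M L).E b ≤ S) → ¬ IsPredecessor M a b := by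
    intro a b hab hmab hb hpr
    rcases hpr.cases L with ⟨h1, -⟩ | ⟨-, h1, h2⟩
    · exact hmab h1
    · have h3 := (levels M L).O_odd (v := b)
      have h4 := (levels M L).E_even (v := b)
      unfold Levels.ten at hb
      omega
  refine ⟨⟨h, ?_⟩, (edgeTenacity_unmatched (by omega) hm).2 hsum⟩
  rintro ⟨a, b, hpr, heq⟩
  rcases Sym2.eq_iff.1 heq with ⟨rfl, rfl⟩ | ⟨rfl, rfl⟩
  · exact hpred _ _ hsum hm hv hpr
  · exact hpred _ _ (by omega) (fun h => hm h.symm) hu hpr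

theorem bridgeOf_matched (hS : (levels M L).Stage (S + 1)) {w z : V} (h : M.Adj w z)
    (hw : (levels M L).O w = S) (hz : (levels M L).O z = S) : BridgeOf M S s(w, z) := by
  have hcap := hS.cap
  have h1 := (levels M L).E_mate hS.matching h
  have h2 := (levels M L).E_mate hS.matching h.symm
  refine ⟨⟨M.adj_sub h, ?_⟩, (edgeTenacity_matched (L := L) (by omega) h).2 (by omega)⟩
  rintro ⟨a, b, hpr, heq⟩
  rcases Sym2.eq_iff.1 heq with ⟨rfl, rfl⟩ | ⟨rfl, rfl⟩
  · rcases hpr.cases L with ⟨-, h3⟩ | ⟨h3, -⟩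
    · omega
    · exact h3 h
  · rcases hpr.cases L with ⟨-, h3⟩ | ⟨h3, -⟩
    · omega
    · exact h3 h.symm

section Steps

variable {x : ℕ → V} {n : ℕ}

/-- The number of bridges of tenacity `2 * S + 1` among the two edges of a double step that starts
on the rising part of a tight path: one if the path turns there, otherwise none. -/
theorem bridges_of_up (hS : (levels M L).Stage (S + 1)) (h : (levels M L).Tight (S + 1) x n)
    {j : ℕ} (hj : Even j) (hjn : j + 2 ≤ n) (hu : (levels M L).Up S x j) :
    ((levels M L).Up S x (j + 2) → ¬ BridgeOf M S s(x j, x (j + 1)) ∧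
      ¬ BridgeOf M S s(x (j + 1), x (j + 2))) ∧
    ((levels M L).Down S x (j + 2) → (BridgeOf M S s(x j, x (j + 1)) ∧
      ¬ BridgeOf M S s(x (j + 1), x (j + 2))) ∨ (¬ BridgeOf M S s(x j, x (j + 1)) ∧
      BridgeOf M S s(x (j + 1), x (j + 2)))) := by
  have hcap := hS.cap
  obtain ⟨hadj, hnm, hmz⟩ := h.adj_step hj hjn
  obtain ⟨hs, hex⟩ := h.step hS hj hjn
  have hexS := hex S (by omega)
  have hmate := Levels.ten_mate (D := levels M L) hS.matching (s := S) (by omega) hmz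
  have hna : ¬ (levels M L).Away S x j := fun ha => hu.not_down hS (Or.inr ha)
  have hx : (levels M L).ten (x j) < 2 * S ∨ (levels M L).E (x j) ≤ S := by
    by_contra hc
    exact hc (Or.inr (hu.E_le hS (by omega)))
  unfold Levels.excess at hexS
  rw [ind_of_not hna] at hexS
  by_cases hw : (levels M L).ten (x (j + 1)) < 2 * S
  · rw [ind_of hw] at hexS
    have hlow := not_bridgeOf_matched_low hS hmz hw
    rcases ind_eq (p := (levels M L).Sim S (x j) (x (j + 1))) with ⟨hsim, es⟩ | ⟨hsim, es⟩
    · refine ⟨fun _ => ⟨not_bridgeOf_sim hS hadj hnm hs hsim, hlow⟩, ?_⟩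
      rintro (h' | h')
      · omega
      · rw [es, ind_of h'] at hexS; omega
    · refine ⟨fun hu' => ?_, fun _ => Or.inl
        ⟨bridgeOf_unmatched hS hadj hnm hs hsim hx (Or.inl hw), hlow⟩⟩
      rcases ind_eq (p := (levels M L).Away S x (j + 2)) with h' | h'
      · exact absurd (Or.inr h'.1) (hu'.not_down hS)
      · omega
  · have hz : 2 * S ≤ (levels M L).ten (x (j + 2)) := by omega
    rw [ind_of_not hw, ind_of_not (Levels.not_away_of_base (j := j + 2) hz)] at hexS
    have hsim : ¬ (levels M L).Sim S (x j) (x (j + 1)) := fun h => by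
      rw [ind_of h] at hexS; omega
    by_cases hE : (levels M L).E (x (j + 1)) ≤ S
    · have hOz := Levels.O_mate_le hS hmz hE
      refine ⟨fun hu' => absurd (Or.inl ⟨hz, by omega⟩) (hu'.not_down hS), fun _ => Or.inl
        ⟨bridgeOf_unmatched hS hadj hnm hs hsim hx (Or.inr hE),
          not_bridgeOf_matched hS hmz (by omega) hE⟩⟩
    · rw [Levels.slack_comm] at hs
      have hnm' : ¬ M.Adj (x (j + 1)) (x j) := fun h => hnm h.symm
      have hO := Levels.not_tight_of_late hS hadj.symm hnm' hs (by omega) (by omega)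
      obtain ⟨-, hOE, hlt⟩ := Levels.tight_inner hS hadj.symm hnm' hs (by omega) hO
      have hb1 := not_bridgeOf_unmatched hS hadj hnm hO hOE hlt
      refine ⟨fun hu' => ⟨hb1, ?_⟩, ?_⟩
      · rw [Sym2.eq_swap]
        exact not_bridgeOf_matched hS hmz.symm hz (hu'.E_le hS hz)
      · rintro (⟨-, hOz⟩ | h')
        · have h1 := (levels M L).E_mate hS.matching hmz
          have h2 := (levels M L).E_mate hS.matching hmz.symm
          have h3 := (levels M L).O_odd (v := x (j + 1))
          have h4 := (levels M L).O_odd (v := x (j + 2))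
          have h5 := (levels M L).E_even (v := x (j + 2))
          have hw' := not_lt.1 hw
          unfold Levels.ten at hz hw'
          exact Or.inr ⟨hb1, bridgeOf_matched hS hmz (by omega) (by omega)⟩
        · exact absurd h' (Levels.not_away_of_base hz)

/-- There is no bridge of tenacity `2 * S + 1` on the falling part of a tight path. -/
theorem bridges_of_down (hS : (levels M L).Stage (S + 1)) (h : (levels M L).Tight (S + 1) x n)
    {j : ℕ} (hj : Even j) (hjn : j + 2 ≤ n) (hd : (levels M L).Down S x j) :
    ¬ BridgeOf M S s(x j, x (j + 1)) ∧ ¬ BridgeOf M S s(x (j + 1), x (j + 2)) := by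
  have hcap := hS.cap
  obtain ⟨hadj, hnm, hmz⟩ := h.adj_step hj hjn
  obtain ⟨hs, hex⟩ := h.step hS hj hjn
  have hexS := hex S (by omega)
  have hmate := Levels.ten_mate (D := levels M L) hS.matching (s := S) (by omega) hmz
  have hsecond : ((levels M L).ten (x (j + 1)) < 2 * S ∨ (levels M L).E (x (j + 1)) ≤ S) →
      ¬ BridgeOf M S s(x (j + 1), x (j + 2)) := by
    intro h
    by_cases hw : (levels M L).ten (x (j + 1)) < 2 * S
    · exact not_bridgeOf_matched_low hS hmz hw
    · exact not_bridgeOf_matched hS hmz (by omega) (by omega)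
  rcases hd with ⟨hb, hO⟩ | ha
  · obtain ⟨-, hOE, hlt⟩ := Levels.tight_inner hS hadj hnm hs hb hO
    refine ⟨?_, hsecond (Or.inr (by omega))⟩
    rw [Sym2.eq_swap]
    exact not_bridgeOf_unmatched hS hadj.symm (fun h => hnm h.symm) hO hOE hlt
  · unfold Levels.excess at hexS
    rw [ind_of ha] at hexS
    have hsim : (levels M L).Sim S (x j) (x (j + 1)) := by
      by_contra hns
      rw [ind_of_not hns] at hexS
      rcases ind_eq (p := (levels M L).ten (x (j + 1)) < 2 * S) with ⟨hw, ew⟩ | ⟨hw, ew⟩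
      · rcases ind_eq (p := (levels M L).Away S x (j + 2)) with h' | h' <;> omega
      · rw [ew, ind_of_not (Levels.not_away_of_base (j := j + 2) (by omega))] at hexS
        omega
    refine ⟨not_bridgeOf_sim hS hadj hnm hs hsim, hsecond ?_⟩
    by_cases hw : (levels M L).ten (x (j + 1)) < 2 * S
    · exact Or.inl hw
    · exact Or.inr (Levels.base_outer hS.matching (by omega) hsim.symm hadj.ne' (by omega)).1

/-- The bridges of tenacity `2 * S + 1` on a tight path that turns at `m` are confined to the
double step at `m`, which contains exactly one. -/
theorem Levels.Tight.bridges (hS : (levels M L).Stage (S + 1))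
    (h : (levels M L).Tight (S + 1) x n) {m : ℕ} (hm : Even m) (hmn : m ≤ n)
    (hu : (levels M L).Up S x m)
    (hd : ∀ j, m < j → j ≤ n → Even j → (levels M L).Down S x j) :
    (∀ i < n, BridgeOf M S s(x i, x (i + 1)) → m < n) ∧
    (m < n → ∃ i < n, BridgeOf M S s(x i, x (i + 1)) ∧
      ∀ i' < n, BridgeOf M S s(x i', x (i' + 1)) → i' = i) := by
  have hne := Nat.even_iff.1 h.even
  have hme := Nat.even_iff.1 hm
  have hother : ∀ j, Even j → j + 2 ≤ n → j ≠ m → ¬ BridgeOf M S s(x j, x (j + 1)) ∧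
      ¬ BridgeOf M S s(x (j + 1), x (j + 2)) := by
    intro j hj hjn hjm
    rcases lt_or_gt_of_ne hjm with hlt | hgt
    · have hj' := Nat.even_iff.1 hj
      exact (bridges_of_up hS h hj hjn (hu.of_le hS h hj hm hlt.le hmn)).1
        (hu.of_le hS h (hj.add even_two) hm (by omega) hmn)
    · exact bridges_of_down hS h hj hjn (hd j hgt (by omega) hj)
  have hloc : ∀ i < n, BridgeOf M S s(x i, x (i + 1)) → i = m ∨ i = m + 1 := by
    intro i hi hb
    rcases Nat.even_or_odd' i with ⟨a, rfl | rfl⟩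
    · by_contra hc
      exact (hother (2 * a) (even_two_mul a) (by omega) (by omega)).1 hb
    · by_contra hc
      exact (hother (2 * a) (even_two_mul a) (by omega) (by omega)).2 hb
  refine ⟨fun i hi hb => ?_, fun hlt => ?_⟩
  · have := hloc i hi hb; omega
  · have hmn' : m + 2 ≤ n := by omega
    rcases (bridges_of_up hS h hm hmn' hu).2 (hd (m + 2) (by omega) hmn' (hm.add even_two)) with
      ⟨h1, h2⟩ | ⟨h1, h2⟩
    · refine ⟨m, by omega, h1, fun i hi hb => ?_⟩
      rcases hloc i hi hb with rfl | rfl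
      · rfl
      · exact absurd hb h2
    · refine ⟨m + 1, by omega, h2, fun i hi hb => ?_⟩
      rcases hloc i hi hb with rfl | rfl
      · exact absurd hb h1
      · rfl

theorem exists_unique_bridge_of_even (hS : (levels M L).Stage (S + 1)) (hx : Alt M x n)
    (hn : Even n) (hE : (levels M L).E (x n) = n) (ht : (levels M L).ten (x n) = 2 * S + 1)
    (hlt : (levels M L).O (x n) < n) :
    ∃ i < n, BridgeOf M S s(x i, x (i + 1)) ∧
      ∀ i' < n, BridgeOf M S s(x i', x (i' + 1)) → i' = i := by
  have htt := (Levels.tight_of_even hS hx hn hE (Levels.kap_of_ten_le ht.le)).1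
  have hO : (levels M L).O (x n) ≤ S := by unfold Levels.ten at ht; omega
  obtain ⟨m, hmn, hm, hu, hd⟩ := htt.exists_turn hS fun _ _ => hO
  refine (htt.bridges hS hm hmn hu hd).2 (lt_of_le_of_ne hmn ?_)
  rintro rfl
  exact hu.not_down hS (Or.inl ⟨by omega, hO⟩)

theorem exists_unique_bridge_of_odd (hS : (levels M L).Stage (S + 1)) (hx : Alt M x (n + 1))
    (hn : Even n) (hO : (levels M L).O (x (n + 1)) = n + 1)
    (ht : (levels M L).ten (x (n + 1)) = 2 * S + 1) (hlt : (levels M L).E (x (n + 1)) < n + 1) :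
    ∃ i < n + 1, BridgeOf M S s(x i, x (i + 1)) ∧
      ∀ i' < n + 1, BridgeOf M S s(x i', x (i' + 1)) → i' = i := by
  have hsum : (levels M L).E (x (n + 1)) + (n + 1) = 2 * S + 1 := by
    unfold Levels.ten at ht; omega
  obtain ⟨htt, hs, haw⟩ := Levels.tight_of_odd hS hx hn
    (by rw [Levels.kap_of_ten_le ht.le]; omega) (by rw [ht]; omega)
  have hadj := hx.adj n (by omega)
  have hnm : ¬ M.Adj (x n) (x (n + 1)) :=
    fun h => Nat.not_even_iff_odd.2 ((hx.mem_iff n (by omega)).1 h) hn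
  obtain ⟨m, hmn, hm, hu, hd⟩ := htt.exists_turn hS fun hb hE =>
    Levels.not_tight_of_late hS hadj hnm hs hb hE
  obtain ⟨hb1, hb2⟩ := htt.bridges hS hm hmn hu hd
  rcases hmn.lt_or_eq with hmn' | rfl
  · -- The path has turned before its last edge, which is then not a bridge of tenacity `2 * S + 1`.
    have hlast : ¬ BridgeOf M S s(x n, x (n + 1)) := by
      rcases hd n hmn' le_rfl hn with ⟨hb, hOn⟩ | ha
      · obtain ⟨-, hOE, hlt⟩ := Levels.tight_inner hS hadj hnm hs hb hOn
        rw [Sym2.eq_swap]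
        exact not_bridgeOf_unmatched hS hadj.symm (fun h => hnm h.symm) hOn hOE hlt
      · exact not_bridgeOf_sim hS hadj hnm hs ((haw S (by omega)).1 ha)
    obtain ⟨i, hi, hbi, huniq⟩ := hb2 hmn'
    refine ⟨i, by omega, hbi, fun i' hi' hb' => ?_⟩
    rcases (Nat.lt_succ_iff.1 hi').lt_or_eq with h | rfl
    · exact huniq i' h hb'
    · exact absurd hb' hlast
  · refine ⟨m, by omega, bridgeOf_unmatched hS hadj hnm hs ?_ ?_ (Or.inr (by omega)),
      fun i hi hb => ?_⟩
    · exact fun hsim => hu.not_down hS (Or.inr ((haw S (by omega)).2 hsim))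
    · by_contra hc
      exact hc (Or.inr (hu.E_le hS (by omega)))
    · rcases (Nat.lt_succ_iff.1 hi).lt_or_eq with h | rfl
      · exact absurd (hb1 i h hb) (lt_irrefl _)
      · rfl

end Steps

/-- An odd path that ends at an unmatched vertex is augmenting. -/
theorem minAugLength_le_O {f : V} (hf : f ∉ M.verts) (hL : (levels M L).O f < L) :
    minAugLength M ≤ (levels M L).O f := by
  obtain ⟨ho, x, hx, hxf⟩ := (levels M L).O_att f hL
  generalize (levels M L).O f = n at *
  subst hxf
  obtain ⟨p, hp, -, h1, h2⟩ := hx.exists_isAlternatingPathTo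
  rw [← hp]
  refine iInf_le_of_le _ (iInf_le_of_le _ (iInf_le_of_le p (iInf_le_of_le ⟨?_, h1, hf, h2⟩ le_rfl)))
  intro h
  have := hx.inj _ (Nat.zero_le _) _ le_rfl h
  rw [← this] at ho
  exact Nat.not_odd_zero ho

end AltPath

theorem mainTheorem2 {V : Type*} [Finite V] (G : SimpleGraph V) (M : G.Subgraph)
    (hM : M.IsMatching) (v : V) (t : ℕ∞) (ht : AltPath.tenacity M v = t)
    (htl : t ≤ AltPath.minAugLength M) (f : V) (p : G.Walk f v)
    (hp : AltPath.IsMaxLevelPath M p) :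
    ∃! e : Sym2 V, e ∈ p.edges ∧ AltPath.IsBridgeEdge M e ∧ AltPath.edgeTenacity M e = t := by
  open AltPath in
  obtain ⟨hlev, hmax⟩ := hp
  have hEle : evenLevel M v ≤ p.length := by rw [hmax]; exact le_max_left _ _
  have hOle : oddLevel M v ≤ p.length := by rw [hmax]; exact le_max_right _ _
  obtain ⟨e, he⟩ := ENat.ne_top_iff_exists.1 (ne_top_of_le_ne_top (ENat.natCast_ne_top _) hEle)
  obtain ⟨o, ho⟩ := ENat.ne_top_iff_exists.1 (ne_top_of_le_ne_top (ENat.natCast_ne_top _) hOle)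
  have hee := Nat.even_iff.1 (exists_of_evenLevel_eq he.symm).1
  have hoo := Nat.odd_iff.1 (exists_of_oddLevel_eq ho.symm).1
  obtain ⟨S, hS⟩ : ∃ S, e + o = 2 * S + 1 := ⟨(e + o) / 2, by omega⟩
  have htS : t = (2 * S + 1 : ℕ) := by
    rw [← ht, tenacity, ← he, ← ho, ← hS]; exact (Nat.cast_add e o).symm
  have hE : (levels M (2 * S + 3)).E v = e := by
    change trunc _ (evenLevel M v) = _
    rw [← he, trunc_coe]; omega
  have hO : (levels M (2 * S + 3)).O v = o := by
    change trunc _ (oddLevel M v) = _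
    rw [← ho, trunc_coe]; omega
  have hstage : (levels M (2 * S + 3)).Stage (S + 1) := by
    refine Levels.stage_of_free hM (Nat.succ_pos S) (by omega) fun f hf => ?_
    by_contra hc
    have h1 := htl.trans (minAugLength_le_O (L := 2 * S + 3) hf (by omega))
    rw [htS] at h1
    have : 2 * S + 1 ≤ _ := Nat.cast_le.1 h1
    omega
  have hpe : ((p.length : ℕ) : ℕ∞) = (max e o : ℕ) := by
    rw [hmax, maxLevel, ← he, ← ho]
    rcases le_total e o with h | h <;> simp [h]
  have hlen : p.length = max e o := by exact_mod_cast hpe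
  have halt : Alt M p.getVert p.length := by
    rcases hlev with h | h <;> exact h.1.alt
  have hend := p.getVert_length
  have hkey : ∃ i < p.length, BridgeOf M S s(p.getVert i, p.getVert (i + 1)) ∧
      ∀ i' < p.length, BridgeOf M S s(p.getVert i', p.getVert (i' + 1)) → i' = i := by
    rcases Nat.lt_or_ge o e with hoe | hoe
    · exact exists_unique_bridge_of_even hstage halt (Nat.even_iff.2 (by omega))
        (by rw [hend]; omega) (by rw [hend]; unfold Levels.ten; omega) (by rw [hend]; omega)
    · obtain ⟨n, hn⟩ : ∃ n, p.length = n + 1 := ⟨p.length - 1, by omega⟩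
      have hend' : p.getVert (n + 1) = v := hn ▸ hend
      rw [hn] at halt ⊢
      exact exists_unique_bridge_of_odd hstage halt (Nat.even_iff.2 (by omega))
        (by rw [hend']; omega) (by rw [hend']; unfold Levels.ten; omega) (by rw [hend']; omega)
  obtain ⟨i, hi, hb, huniq⟩ := hkey
  refine ⟨s(p.getVert i, p.getVert (i + 1)), ⟨?_, hb.1, hb.2.trans htS.symm⟩, ?_⟩
  · rw [← SimpleGraph.Walk.getElem_edges (by rwa [SimpleGraph.Walk.length_edges])]
    exact List.getElem_mem _
  · rintro e' ⟨hmem, h1, h2⟩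
    obtain ⟨i', hi', rfl⟩ := List.getElem_of_mem hmem
    rw [SimpleGraph.Walk.length_edges] at hi'
    rw [SimpleGraph.Walk.getElem_edges] at h1 h2 ⊢
    rw [huniq i' hi' ⟨h1, h2.trans htS⟩]
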